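/- \textbf{Setting.} Let $n\ge 1$, let $M$ be a Riemann surface (a connected one-dimensional complex manifold), and let $G_*(\mathbb C^n)$ be the disjoint union of the Grassmannians $G_k(\mathbb C^n)$, $0\le k\le n$. A smooth map $\varphi:M\to G_*(\mathbb C^n)$ is identified with a smooth subbundle of $\underline{\mathbb C}^n=M\times\mathbb C^n$ and with the map $\pi_\varphi-\pi_{\varphi}^{\perp}:M\to \mathrm U(n)$, where $\pi$ denotes orthogonal projection. In a local complex coordinate $z$ put $A^\varphi_z=\frac12\varphi^{-1}\varphi_z$, $A^\varphi_{\bar z}=\frac12\varphi^{-1}\varphi_{\bar z}$ and $D^\varphi_{\bar z}=\partial_{\bar z}+A^\varphi_{\bar z}$. An \emph{$A^\varphi_z$-filtration} of length $t\geq 0$ is a sequence of smooth subbundles $\underline{\mathbb C}^n=Z_0\supseteq Z_1\supseteq\cdots\supseteq Z_t\supseteq Z_{t+1}=0$ such that, in each coordinate domain, the smooth sections of every $Z_i$ are closed under $D^\varphi_{\bar z}$, and $A^\varphi_z$ maps $Z_i$ into $Z_{i+1}$ for $0\le i\le t$. It \emph{splits for $\varphi$} if $Z_i=(Z_i\cap\varphi)\oplus(Z_i\cap\varphi^\perp)$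 for every $i$; then put $\widehat\psi_{2i}=(Z_i\cap Z_{i+1}^\perp)\cap\varphi$ and $\widehat\psi_{2i+1}=(Z_i\cap Z_{i+1}^\perp)\cap\varphi^\perp$ for $0\le i\le t$. For positive integers $d_0,\dots,d_s$ with sum $n$, let $F_{d_0,\dots,d_s}$ be the flag manifold of tuples $\psi=(\psi_0,\dots,\psi_s)$ of mutually orthogonal subspaces (legs) with $\dim\psi_i=d_i$ and $\bigoplus_i\psi_i=\mathbb C^n$ (a point if $s=0$). Let $J_2$ be the almost complex structure on it whose $(1,0)$-tangent space at $\psi$ is the sum of the $\mathrm{Hom}(\psi_i,\psi_j)$ with $j-i$ positive and odd or $i-j$ positive and even, and let $\pi_e(\psi)=\sum_{i\text{ even}}\psi_i$. A \emph{$J_2$-holomorphic twistor lift} of $\varphi$ is a smooth map $\psi:M\to F_{d_0,\dots,d_s}$ that is holomorphic with respect to $J_2$ and satisfies $\pi_e\circ\psi=\varphi$. For mutually orthogonal subbundles $\alpha,\beta$ of $\underline{\mathbb C}^n$ let $A'_{\alpha,\beta}:\alpha\to\beta$ be given by $A'_{\alpha,\beta}(v)=\pi_\beta(\partial_z v)$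 for local smooth sections $v$ of $\alpha$. \textbf{Proposition.} Let $\varphi:M\to G_*(\mathbb C^n)$ be a smooth map and let $(Z_i)$ be an $A^\varphi_z$-filtration of length $t$ which splits for $\varphi$. Then there are $s\ge 0$, positive integers $d_0,\dots,d_s$ with sum $n$, and a $J_2$-holomorphic twistor lift $\psi=(\psi_0,\dots,\psi_s):M\to F_{d_0,\dots,d_s}$ of $\varphi$ or of $\varphi^\perp$ such that every leg $\psi_i$ is the sum of some of the subbundles $\widehat\psi_j$, $0\le j\le 2t+1$, and such that, if $\varphi$ is not constant, then $A'_{\psi_i,\psi_{i+1}}$ is not identically zero for each $i=0,\dots,s-1$. Moreover $s\ge 1$ unless $\varphi$ is identically $0$ or identically $\mathbb C^n$. -/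

import Mathlib

open scoped Manifold ContDiff

noncomputable section

namespace TwistorLift

/-- The Hermitian space `ℂⁿ`. -/
abbrev Cn (n : ℕ) := EuclideanSpace ℂ (Fin n)

/-- Complex-linear endomorphisms of `ℂⁿ`. -/
abbrev End (n : ℕ) := Cn n →L[ℂ] Cn n

section Calculus

variable {M : Type*} [TopologicalSpace M] [ChartedSpace ℂ M]

/-- Local complex coordinates of the Riemann surface `M`: `(e.source, e)` is a coordinate domain
`(U, z)`. -/
def IsCoord (e : OpenPartialHomeomorph M ℂ) : Prop :=
  e ∈ IsManifold.maximalAtlas 𝓘(ℂ) ω M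

variable {F : Type*} [NormedAddCommGroup F] [NormedSpace ℂ F]

/-- The real differential of `f`, at the point `p` of the coordinate domain of `e`, in the
coordinate `z = x + i y = e`: it sends `1` to `∂f/∂x` and `I` to `∂f/∂y`. -/
def diffIn (e : OpenPartialHomeomorph M ℂ) (f : M → F) (p : M) : ℂ →L[ℝ] F :=
  fderiv ℝ (fun w => f (e.symm w)) (e p)

/-- `∂f/∂z = (∂f/∂x - i ∂f/∂y) / 2`. -/
def dz (e : OpenPartialHomeomorph M ℂ) (f : M → F) (p : M) : F :=
  (1 / 2 : ℂ) • (diffIn e f p 1 - Complex.I • diffIn e f p Complex.I)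

/-- `∂f/∂z̄ = (∂f/∂x + i ∂f/∂y) / 2`. -/
def dzbar (e : OpenPartialHomeomorph M ℂ) (f : M → F) (p : M) : F :=
  (1 / 2 : ℂ) • (diffIn e f p 1 + Complex.I • diffIn e f p Complex.I)

end Calculus

/-- Orthogonal projection `π_V` of `ℂⁿ` onto `V`, as an endomorphism of `ℂⁿ`. -/
def proj {n : ℕ} (V : Submodule ℂ (Cn n)) : End n := V.starProjection

/-- The Cartan embedding `ι(V) = π_V - π_{V^⊥}` of `G_*(ℂⁿ)` into the unitary group. -/
def cartan {n : ℕ} (V : Submodule ℂ (Cn n)) : unitary (End n) :=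
  ⟨proj V - proj Vᗮ, by
    have h : proj V - proj Vᗮ = 2 * proj V - 1 := by
      unfold proj
      rw [Submodule.starProjection_orthogonal']
      noncomm_ring
    rw [h]
    exact IsStarProjection.two_mul_sub_one_mem_unitary
      ⟨V.isIdempotentElem_starProjection, isSelfAdjoint_starProjection V⟩⟩

section Bundles

variable {M : Type*} [TopologicalSpace M] [ChartedSpace ℂ M] {n : ℕ}

/-- A family of subspaces of `ℂⁿ` is a smooth map `M → G_*(ℂⁿ)`, equivalently a smooth subbundle
of `M × ℂⁿ`, if its composition with the Cartan embedding is `C^∞`. -/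
def IsSubbundle (W : M → Submodule ℂ (Cn n)) : Prop :=
  ContMDiff 𝓘(ℝ, ℂ) 𝓘(ℝ, End n) ∞ (fun p => (cartan (W p) : End n))

/-- `s` is a smooth section of `W` over the open set `U`. -/
def IsSectionOn (W : M → Submodule ℂ (Cn n)) (U : Set M) (s : M → Cn n) : Prop :=
  ContMDiffOn 𝓘(ℝ, ℂ) 𝓘(ℝ, Cn n) ∞ s U ∧ ∀ q ∈ U, s q ∈ W q

/-- `A^Φ_z = (1/2) Φ⁻¹ Φ_z`. -/
def Az (Φ : M → unitary (End n)) (e : OpenPartialHomeomorph M ℂ) (p : M) : End n :=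
  (1 / 2 : ℂ) • (((Φ p)⁻¹ : unitary (End n)) * dz e (fun q => (Φ q : End n)) p)

/-- `A^Φ_z̄ = (1/2) Φ⁻¹ Φ_z̄`. -/
def Azbar (Φ : M → unitary (End n)) (e : OpenPartialHomeomorph M ℂ) (p : M) : End n :=
  (1 / 2 : ℂ) • (((Φ p)⁻¹ : unitary (End n)) * dzbar e (fun q => (Φ q : End n)) p)

/-- `W` is a holomorphic subbundle of `(M × ℂⁿ, D^Φ_z̄)`, `D^Φ_z̄ = ∂_z̄ + A^Φ_z̄`: on each
coordinate domain its smooth sections are closed under `D^Φ_z̄`. -/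
def IsHolSubbundle (Φ : M → unitary (End n)) (W : M → Submodule ℂ (Cn n)) : Prop :=
  IsSubbundle W ∧
    ∀ e : OpenPartialHomeomorph M ℂ, IsCoord e → ∀ s : M → Cn n, IsSectionOn W e.source s →
      ∀ p ∈ e.source, dzbar e s p + Azbar Φ e p (s p) ∈ W p

/-- `ℂⁿ = Z 0 ⊇ Z 1 ⊇ ⋯ ⊇ Z t ⊇ Z (t+1) = 0` is an `A^Φ_z`-filtration of length `t`.
The values `Z i` with `i > t + 1` play no role. -/
structure IsAzFiltration (Φ : M → unitary (End n)) (t : ℕ) (Z : ℕ → M → Submodule ℂ (Cn n)) :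
    Prop where
  top : ∀ p, Z 0 p = ⊤
  bot : ∀ p, Z (t + 1) p = ⊥
  anti : ∀ i ≤ t, ∀ p, Z (i + 1) p ≤ Z i p
  hol : ∀ i ≤ t + 1, IsHolSubbundle Φ (Z i)
  maps : ∀ i ≤ t, ∀ e : OpenPartialHomeomorph M ℂ, IsCoord e → ∀ p ∈ e.source,
    ∀ v ∈ Z i p, Az Φ e p v ∈ Z (i + 1) p

/-- The filtration splits for `φ`: each `Z i` is the sum of a part in `φ` and a part in `φ^⊥`. -/
def Splits (φ : M → Submodule ℂ (Cn n)) (t : ℕ) (Z : ℕ → M → Submodule ℂ (Cn n)) : Prop :=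
  ∀ i ≤ t + 1, ∀ p, Z i p = (Z i p ⊓ φ p) ⊔ (Z i p ⊓ (φ p)ᗮ)

/-- The leg `Z i ⊖ Z (i+1)` of the filtration. -/
def filtLeg (Z : ℕ → M → Submodule ℂ (Cn n)) (i : ℕ) (p : M) : Submodule ℂ (Cn n) :=
  (Z (i + 1) p)ᗮ ⊓ Z i p

/-- The pieces `ψ̂_{2i} = (Z i ⊖ Z (i+1)) ∩ φ` and `ψ̂_{2i+1} = (Z i ⊖ Z (i+1)) ∩ φ^⊥`. -/
def piece (φ : M → Submodule ℂ (Cn n)) (Z : ℕ → M → Submodule ℂ (Cn n)) (j : ℕ) (p : M) :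
    Submodule ℂ (Cn n) :=
  filtLeg Z (j / 2) p ⊓ (if Even j then φ p else (φ p)ᗮ)

/-- The `∂'`-second fundamental form `A'_{α,β} : α → β`, `v ↦ π_β (∂_z v)` for sections `v` of
`α`, vanishes identically (for mutually orthogonal subbundles `α`, `β`). -/
def SecondFFZero (α β : M → Submodule ℂ (Cn n)) : Prop :=
  ∀ e : OpenPartialHomeomorph M ℂ, IsCoord e → ∀ v : M → Cn n, IsSectionOn α e.source v →
    ∀ p ∈ e.source, proj (β p) (dz e v p) = 0

end Bundles

/-- The flag manifold `F_{d_0,…,d_t} = U(n) / U(d_0) × ⋯ × U(d_t)`: tuples of mutually orthogonal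
subspaces (legs) of dimensions `d_0, …, d_t` with sum `ℂⁿ`. -/
structure Flag (n : ℕ) {t : ℕ} (d : Fin (t + 1) → ℕ) where
  leg : Fin (t + 1) → Submodule ℂ (Cn n)
  finrank_leg : ∀ i, Module.finrank ℂ (leg i) = d i
  ortho : ∀ i j, i ≠ j → leg i ⟂ leg j
  sum_eq_top : ⨆ i, leg i = ⊤

namespace Flag

variable {n t : ℕ} {d : Fin (t + 1) → ℕ}

/-- The twistor projection `π_e`: the sum of the even legs. -/
def evenSum (ψ : Flag n d) : Submodule ℂ (Cn n) :=
  ⨆ i : Fin (t + 1), ⨆ _ : Even (i : ℕ), ψ.leg i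

/-- `Hom(ψ_i, ψ_j)` is contained in the `(1,0)`-tangent space of `J₂`: this is so for `i < j` with
`j - i` odd (horizontal part, where `J₂ = J₁`) and for `j < i` with `i - j` even (vertical part,
where `J₂ = - J₁`). -/
def IsOneZero (i j : Fin (t + 1)) : Prop :=
  (i < j ∧ Odd ((i : ℕ) + j)) ∨ (j < i ∧ Even ((i : ℕ) + j))

open Classical in
/-- The almost complex structure `J₂` of the flag manifold. The flag manifold is regarded as a
submanifold of the real vector space `End(ℂⁿ)^(t+1)` by `ψ ↦ (π_{ψ_0}, …, π_{ψ_t})`, so a tangent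
vector at `ψ` is a tuple `X` of Hermitian endomorphisms. Its component in `Hom(ψ_i, ψ_j)` is
`π_{ψ_j} X_i π_{ψ_i}`, for `i ≠ j`, and `X_i` is the sum over `j ≠ i` of these components and of
their adjoints `π_{ψ_i} X_i π_{ψ_j}`. The structure `J₂` multiplies the component in
`Hom(ψ_i, ψ_j)` by `I` if this is of type `(1,0)`, and by `-I` otherwise. -/
def J2 (ψ : Flag n d) (X : Fin (t + 1) → End n) (i : Fin (t + 1)) : End n :=
  ∑ j ∈ Finset.univ.erase i, (if IsOneZero i j then Complex.I else -Complex.I) •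
    (proj (ψ.leg j) * X i * proj (ψ.leg i) - proj (ψ.leg i) * X i * proj (ψ.leg j))

end Flag

section FlagMaps

variable {M : Type*} [TopologicalSpace M] [ChartedSpace ℂ M] {n t : ℕ} {d : Fin (t + 1) → ℕ}

/-- A map into a flag manifold is smooth if each leg is a smooth map to a Grassmannian. -/
def SmoothFlagMap (ψ : M → Flag n d) : Prop :=
  ∀ i, IsSubbundle (fun p => (ψ p).leg i)

/-- The differential of a map into the flag manifold, in the coordinate `e`. -/
def flagDiff (ψ : M → Flag n d) (e : OpenPartialHomeomorph M ℂ) (p : M) (v : ℂ) :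
    Fin (t + 1) → End n :=
  fun i => diffIn e (fun q => proj ((ψ q).leg i)) p v

/-- `ψ` is `J₂`-holomorphic: it is smooth and its differential intertwines the complex structure
of `M` with `J₂`. -/
def IsJ2Holomorphic (ψ : M → Flag n d) : Prop :=
  SmoothFlagMap ψ ∧
    ∀ e : OpenPartialHomeomorph M ℂ, IsCoord e → ∀ p ∈ e.source, ∀ v : ℂ,
      flagDiff ψ e p (Complex.I * v) = (ψ p).J2 (flagDiff ψ e p v)

/-- `ψ` is a `J₂`-holomorphic twistor lift of `φ : M → G_*(ℂⁿ)`. -/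
def IsJ2Lift (ψ : M → Flag n d) (φ : M → Submodule ℂ (Cn n)) : Prop :=
  IsJ2Holomorphic ψ ∧ ∀ p, (ψ p).evenSum = φ p

end FlagMaps

end TwistorLift

end

/-! Regard the pieces ψ̂_j as vertices of a directed graph, with an edge a → b when A' from ψ̂_a to
ψ̂_b is not identically zero (`IsEdge`). Between φ and φ^⊥ the form A' agrees up to sign with A^φ_z,
which raises the filtration index, so edges joining different parities go strictly up
(`isEdge_cross`). Between pieces of equal parity A^φ_z̄ has no component, so closure of Z_i under
D^φ_z̄ speaks of ∂_z̄ alone; its adjoint says that such edges never go up (`isEdge_same`).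

A map into a flag manifold is J₂-holomorphic as soon as A' between distinct legs lives only where
the index rises by an odd or falls by an even amount (`isJ2Holomorphic_of_isEdge`). Hence every
placement of the nonzero pieces at positions 0, …, s satisfying `IsLevel` gives, by summing the
pieces at each position, a J₂-holomorphic map, provided that no leg is empty; its even legs add up
to φ or φ^⊥. The identity placement satisfies `IsLevel`.

Choose a placement with s minimal. If s ≥ 2 and no edge runs from position i to i + 1, then
`IsLevel.collapse` shortens it; so all these edges exist, and no position is empty. For s = 1 an
empty position would allow s = 0, and the edge from 0 to 1 exists once some edge joins different
parities. When φ is not constant there is such an edge, since otherwise the derivative of π_φ would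
vanish (`constant_of_not_isEdge`). -/

noncomputable section

namespace TwistorLift

/-! ### Holomorphic charts as real smooth charts -/

section RealCoordinates

variable {M : Type*} [TopologicalSpace M] [ChartedSpace ℂ M]

/-- A holomorphic coordinate change is real smooth. -/
theorem contDiffGroupoid_complex_le_real :
    (contDiffGroupoid ω 𝓘(ℂ) : StructureGroupoid ℂ) ≤ contDiffGroupoid ∞ 𝓘(ℝ, ℂ) := by
  intro e he
  change _ ∧ _ at he
  change _ ∧ _
  simp only [contDiffPregroupoid, modelWithCornersSelf_coe,
    modelWithCornersSelf_coe_symm, Function.comp_id, Function.id_comp, Set.range_id,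
    Set.preimage_id, Set.inter_univ] at he ⊢
  exact ⟨(he.1.restrict_scalars ℝ).of_le le_top, (he.2.restrict_scalars ℝ).of_le le_top⟩

theorem mem_maximalAtlas_real {e : OpenPartialHomeomorph M ℂ} (he : IsCoord e) :
    e ∈ IsManifold.maximalAtlas 𝓘(ℝ, ℂ) ∞ M := by
  intro e' he'
  exact ⟨contDiffGroupoid_complex_le_real (he e' he').1,
    contDiffGroupoid_complex_le_real (he e' he').2⟩

theorem isManifold_real [IsManifold 𝓘(ℂ) ω M] : IsManifold 𝓘(ℝ, ℂ) ∞ M where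
  compatible := fun he he' => contDiffGroupoid_complex_le_real
    ((inferInstance : IsManifold 𝓘(ℂ) ω M).compatible he he')

theorem isCoord_chartAt [IsManifold 𝓘(ℂ) ω M] (p : M) : IsCoord (chartAt ℂ p) :=
  IsManifold.chart_mem_maximalAtlas p

/-- A smooth map is differentiable when read in a holomorphic coordinate. -/
theorem differentiableAt_coord [IsManifold 𝓘(ℂ) ω M] {F : Type*} [NormedAddCommGroup F]
    [NormedSpace ℝ F] {f : M → F} (hf : ContMDiff 𝓘(ℝ, ℂ) 𝓘(ℝ, F) ∞ f)
    {e : OpenPartialHomeomorph M ℂ} (he : IsCoord e) {w : ℂ} (hw : w ∈ e.target) :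
    DifferentiableAt ℝ (fun w => f (e.symm w)) w := by
  have : IsManifold 𝓘(ℝ, ℂ) ∞ M := isManifold_real
  have h1 : ContMDiffAt 𝓘(ℝ, ℂ) 𝓘(ℝ, ℂ) ∞ e.symm w :=
    contMDiffAt_symm_of_mem_maximalAtlas (mem_maximalAtlas_real he) hw
  have h2 : ContMDiffAt 𝓘(ℝ, ℂ) 𝓘(ℝ, F) ∞ (f ∘ e.symm) w := (hf _).comp w h1
  exact h2.contDiffAt.differentiableAt (by simp)

end RealCoordinates

/-! ### Leibniz and conjugation rules for ∂_z and ∂_z̄ -/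

section Rules

variable {M : Type*} [TopologicalSpace M] {n : ℕ}
  {e : OpenPartialHomeomorph M ℂ} {p : M}

/-- `f` is differentiable at `p` in the coordinate `e`. -/
def DiffAt (e : OpenPartialHomeomorph M ℂ) (f : M → End n) (p : M) : Prop :=
  DifferentiableAt ℝ (fun w => f (e.symm w)) (e p)

variable {f g : M → End n}

theorem diffIn_mul (hp : p ∈ e.source) (hf : DiffAt e f p) (hg : DiffAt e g p) (v : ℂ) :
    diffIn e (fun q => f q * g q) p v = diffIn e f p v * g p + f p * diffIn e g p v := by
  have := HasFDerivAt.mul' (𝕜 := ℝ) hf.hasFDerivAt hg.hasFDerivAt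
  unfold diffIn
  erw [this.fderiv]
  simp [e.left_inv hp, add_comm]

theorem diffIn_star (hf : DiffAt e f p) (v : ℂ) :
    diffIn e (fun q => star (f q)) p v = star (diffIn e f p v) := by
  have := HasFDerivAt.star (𝕜 := ℝ) hf.hasFDerivAt
  unfold diffIn
  erw [this.fderiv]
  simp

theorem diffIn_apply (hf : DiffAt e f p) (w : Cn n) (v : ℂ) :
    diffIn e (fun q => f q w) p v = diffIn e f p v w := by
  let L : End n →L[ℝ] Cn n := (ContinuousLinearMap.apply ℂ (Cn n) w).restrictScalars ℝ
  have := (L.hasFDerivAt (x := f (e.symm (e p)))).comp (e p) hf.hasFDerivAt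
  unfold diffIn
  erw [this.fderiv]
  rfl

theorem diffIn_const (a : End n) (v : ℂ) : diffIn e (fun _ : M => a) p v = 0 := by
  simp [diffIn]

theorem diffIn_sub (hf : DiffAt e f p) (hg : DiffAt e g p) (v : ℂ) :
    diffIn e (fun q => f q - g q) p v = diffIn e f p v - diffIn e g p v := by
  have := hf.hasFDerivAt.sub hg.hasFDerivAt
  unfold diffIn
  erw [this.fderiv]
  rfl

theorem dz_mul (hp : p ∈ e.source) (hf : DiffAt e f p) (hg : DiffAt e g p) :
    dz e (fun q => f q * g q) p = dz e f p * g p + f p * dz e g p := by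
  simp only [dz, diffIn_mul hp hf hg, smul_mul_assoc, mul_smul_comm, ← smul_add, sub_mul, mul_sub]
  congr 1
  simp only [smul_add]
  abel

theorem dzbar_mul (hp : p ∈ e.source) (hf : DiffAt e f p) (hg : DiffAt e g p) :
    dzbar e (fun q => f q * g q) p = dzbar e f p * g p + f p * dzbar e g p := by
  simp only [dzbar, diffIn_mul hp hf hg, smul_mul_assoc, mul_smul_comm, ← smul_add, add_mul,
    mul_add]
  congr 1
  simp only [smul_add]
  abel

theorem dz_sub (hf : DiffAt e f p) (hg : DiffAt e g p) :
    dz e (fun q => f q - g q) p = dz e f p - dz e g p := by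
  simp only [dz, diffIn_sub hf hg, ← smul_sub]
  congr 1
  simp only [smul_sub]
  abel

theorem dzbar_sub (hf : DiffAt e f p) (hg : DiffAt e g p) :
    dzbar e (fun q => f q - g q) p = dzbar e f p - dzbar e g p := by
  simp only [dzbar, diffIn_sub hf hg, ← smul_sub]
  congr 1
  simp only [smul_sub]
  abel

theorem dz_const (a : End n) : dz e (fun _ : M => a) p = 0 := by simp [dz, diffIn_const]

theorem dzbar_const (a : End n) : dzbar e (fun _ : M => a) p = 0 := by simp [dzbar, diffIn_const]

theorem dz_apply (hf : DiffAt e f p) (w : Cn n) : dz e (fun q => f q w) p = dz e f p w := by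
  simp [dz, diffIn_apply hf]

theorem dzbar_apply (hf : DiffAt e f p) (w : Cn n) :
    dzbar e (fun q => f q w) p = dzbar e f p w := by
  simp [dzbar, diffIn_apply hf]

/-- Taking adjoints fixes the real partial derivatives of a self-adjoint field and conjugates the
coefficient `-I`. This is how information on ∂_z̄ becomes information on A'. -/
theorem star_dz (hf : DiffAt e f p) (hs : ∀ q, star (f q) = f q) :
    star (dz e f p) = dzbar e f p := by
  have h : ∀ v, star (diffIn e f p v) = diffIn e f p v := fun v => by
    rw [← diffIn_star hf]; simp only [hs]
  have key : ∀ a b : End n, star a = a → star b = b →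
      star ((1 / 2 : ℂ) • (a - Complex.I • b)) = (1 / 2 : ℂ) • (a + Complex.I • b) := by
    intro a b ha hb
    have h1 : star (a - Complex.I • b) = star a - star (Complex.I • b) := by
      simp only [ContinuousLinearMap.star_eq_adjoint, map_sub]
    rw [star_smul, h1, star_smul, ha, hb, show star Complex.I = -Complex.I by simp,
      show star (1 / 2 : ℂ) = 1 / 2 by simp]
    module
  exact key _ _ (h _) (h _)

theorem star_dzbar (hf : DiffAt e f p) (hs : ∀ q, star (f q) = f q) :
    star (dzbar e f p) = dz e f p := by
  rw [← star_dz hf hs, star_star]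

/-- The real differential in terms of `∂_z` and `∂_z̄`. -/
theorem diffIn_eq (f : M → End n) (v : ℂ) :
    diffIn e f p v = v • dz e f p + (starRingEnd ℂ v) • dzbar e f p := by
  have h : v = v.re • (1 : ℂ) + v.im • Complex.I := by
    simpa [mul_comm] using (Complex.re_add_im v).symm
  have h2 : diffIn e f p v = (v.re : ℂ) • diffIn e f p 1 + (v.im : ℂ) • diffIn e f p Complex.I := by
    conv_lhs => rw [h]
    rw [map_add, map_smul, map_smul]
    rfl
  rw [h2]
  unfold dz dzbar
  have e1 : v = v.re + v.im * Complex.I := (Complex.re_add_im v).symm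
  have e2 : starRingEnd ℂ v = v.re - v.im * Complex.I := by
    apply Complex.ext <;> simp
  rw [e2]
  nth_rewrite 3 [e1]
  simp only [smul_add, smul_sub, smul_smul]
  generalize diffIn e f p 1 = a
  generalize diffIn e f p Complex.I = b
  match_scalars
  · ring
  · linear_combination (v.im : ℂ) * Complex.I_sq

end Rules

/-! ### Orthogonal projections and splitting -/

section Projections

variable {n : ℕ}

theorem proj_apply_eq_self_iff {V : Submodule ℂ (Cn n)} {x : Cn n} : proj V x = x ↔ x ∈ V :=
  Submodule.starProjection_eq_self_iff

theorem proj_mem (V : Submodule ℂ (Cn n)) (x : Cn n) : proj V x ∈ V :=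
  V.starProjection_apply_mem x

theorem proj_mul_self (V : Submodule ℂ (Cn n)) : proj V * proj V = proj V :=
  V.isIdempotentElem_starProjection

theorem star_proj (V : Submodule ℂ (Cn n)) : star (proj V) = proj V :=
  isSelfAdjoint_starProjection V

theorem proj_orthogonal (V : Submodule ℂ (Cn n)) : proj Vᗮ = 1 - proj V :=
  V.starProjection_orthogonal'

theorem eq_proj {T : End n} {V : Submodule ℂ (Cn n)} (h1 : T * T = T) (h2 : star T = T)
    (h3 : ∀ x, T x = x ↔ x ∈ V) : proj V = T := by
  have hT : IsStarProjection T := ⟨h1, h2⟩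
  refine (ContinuousLinearMap.IsStarProjection.ext ⟨proj_mul_self V, star_proj V⟩ hT ?_)
  have hr : ∀ {S : End n}, S * S = S → ∀ x, x ∈ S.range ↔ S x = x := by
    intro S hS x
    refine ⟨?_, fun h => ⟨x, h⟩⟩
    rintro ⟨y, rfl⟩
    exact congrArg (fun f : End n => f y) hS
  ext x
  rw [hr (proj_mul_self V), hr h1, h3, proj_apply_eq_self_iff]

theorem proj_mul_proj_of_le {V W : Submodule ℂ (Cn n)} (h : V ≤ W) :
    proj W * proj V = proj V := by
  ext1 x
  exact proj_apply_eq_self_iff.2 (h (proj_mem V x))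

theorem proj_mul_proj_of_le' {V W : Submodule ℂ (Cn n)} (h : V ≤ W) :
    proj V * proj W = proj V := by
  have := congrArg star (proj_mul_proj_of_le h)
  rwa [star_mul, star_proj, star_proj] at this

theorem proj_mul_proj_of_isOrtho {V W : Submodule ℂ (Cn n)} (h : V ⟂ W) :
    proj V * proj W = 0 :=
  Submodule.IsOrtho.starProjection_comp_starProjection h

theorem proj_apply_eq_zero_of_isOrtho {V W : Submodule ℂ (Cn n)} (h : V ⟂ W) {x : Cn n}
    (hx : x ∈ W) : proj V x = 0 :=
  (Submodule.starProjection_apply_eq_zero_iff V).2 (h.symm hx)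

theorem isOrtho_of_proj_mul_proj {V W : Submodule ℂ (Cn n)} (h : proj V * proj W = 0) :
    V ⟂ W :=
  Submodule.starProjection_comp_starProjection_eq_zero_iff.1 h

/-- The projections onto `Z` and `W` commute if `Z` splits with respect to `W ⊕ Wᗮ`. -/
theorem commute_proj_of_split {Z W : Submodule ℂ (Cn n)} (h : Z = (Z ⊓ W) ⊔ (Z ⊓ Wᗮ)) :
    proj Z * proj W = proj W * proj Z := by
  have h1 : proj Z * (proj W * proj Z) = proj W * proj Z := by
    ext1 x
    refine proj_apply_eq_self_iff.2 ?_
    change proj W (proj Z x) ∈ Z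
    have hx := proj_mem Z x
    generalize proj Z x = y at hx
    rw [h] at hx
    obtain ⟨a, ha, b, hb, rfl⟩ := Submodule.mem_sup.1 hx
    have hb0 : proj W b = 0 := (Submodule.starProjection_apply_eq_zero_iff W).2 hb.2
    rw [map_add, hb0, add_zero, proj_apply_eq_self_iff.2 ha.2]
    exact ha.1
  have h2 := congrArg star h1
  rw [star_mul, star_mul, star_proj, star_proj, mul_assoc, h1] at h2
  exact h2.symm

/-- A product of commuting projections projects onto the intersection of their ranges, and `proj Z -
proj Z'` is the projection onto Z ⊖ Z'. The formula matters because intersections of smooth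
subbundles need not be smooth, whereas the right-hand side visibly is when its factors are. -/
theorem proj_orthogonal_inf_inf {Z Z' W : Submodule ℂ (Cn n)} (hle : Z' ≤ Z)
    (h : proj Z * proj W = proj W * proj Z) (h' : proj Z' * proj W = proj W * proj Z') :
    proj (Z'ᗮ ⊓ Z ⊓ W) = (proj Z - proj Z') * proj W := by
  have hQ : IsStarProjection (proj Z - proj Z') :=
    IsStarProjection.sub_of_mul_eq_left ⟨proj_mul_self Z', star_proj Z'⟩
      ⟨proj_mul_self Z, star_proj Z⟩ (proj_mul_proj_of_le' hle)
  have hc : Commute (proj Z - proj Z') (proj W) := Commute.sub_left h h'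
  have hT : IsStarProjection ((proj Z - proj Z') * proj W) :=
    hQ.mul ⟨proj_mul_self W, star_proj W⟩ hc
  refine eq_proj hT.1 hT.2 fun x => ⟨fun hx => ?_, fun hx => ?_⟩
  · have hW : proj W x = x := by
      have : proj W * ((proj Z - proj Z') * proj W) = (proj Z - proj Z') * proj W := by
        rw [← mul_assoc, ← hc.eq, mul_assoc, proj_mul_self]
      conv_lhs => rw [← hx]
      exact (congrArg (fun f : End n => f x) this).trans hx
    have hx' : proj Z x - proj Z' x = x := by
      have : proj Z (proj W x) - proj Z' (proj W x) = x := hx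
      rwa [hW] at this
    have hZ : x ∈ Z := by
      rw [← hx']
      exact Z.sub_mem (proj_mem Z x) (hle (proj_mem Z' x))
    refine ⟨⟨?_, hZ⟩, proj_apply_eq_self_iff.1 hW⟩
    rw [proj_apply_eq_self_iff.2 hZ] at hx'
    exact (Submodule.starProjection_apply_eq_zero_iff Z').1 (sub_eq_self.1 hx')
  · obtain ⟨⟨h1, h2⟩, h3⟩ := hx
    change proj Z (proj W x) - proj Z' (proj W x) = x
    rw [proj_apply_eq_self_iff.2 h3, proj_apply_eq_self_iff.2 h2,
      show proj Z' x = 0 from (Submodule.starProjection_apply_eq_zero_iff Z').2 h1, sub_zero]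

end Projections

/-! ### Smooth families of projections and constancy of rank -/

section Smooth

variable {M : Type*} [TopologicalSpace M] [ChartedSpace ℂ M] {n : ℕ}

/-- `f : M → End ℂⁿ` is smooth. -/
def SmoothEnd (f : M → End n) : Prop := ContMDiff 𝓘(ℝ, ℂ) 𝓘(ℝ, End n) ∞ f

theorem SmoothEnd.mul {f g : M → End n} (hf : SmoothEnd f) (hg : SmoothEnd g) :
    SmoothEnd (fun p => f p * g p) :=
  ((contDiff_fst (𝕜 := ℝ)).mul contDiff_snd : ContDiff ℝ ∞ fun x : End n × End n => x.1 * x.2)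
    |>.contMDiff.comp (hf.prodMk_space hg)

theorem SmoothEnd.sub {f g : M → End n} (hf : SmoothEnd f) (hg : SmoothEnd g) :
    SmoothEnd (fun p => f p - g p) :=
  ((contDiff_fst (𝕜 := ℝ)).sub contDiff_snd : ContDiff ℝ ∞ fun x : End n × End n => x.1 - x.2)
    |>.contMDiff.comp (hf.prodMk_space hg)

theorem SmoothEnd.add {f g : M → End n} (hf : SmoothEnd f) (hg : SmoothEnd g) :
    SmoothEnd (fun p => f p + g p) :=
  ((contDiff_fst (𝕜 := ℝ)).add contDiff_snd : ContDiff ℝ ∞ fun x : End n × End n => x.1 + x.2)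
    |>.contMDiff.comp (hf.prodMk_space hg)

theorem smoothEnd_const (a : End n) : SmoothEnd (fun _ : M => a) := contMDiff_const

theorem SmoothEnd.sum {ι : Type*} {T : ι → M → End n} {S : Finset ι}
    (h : ∀ j ∈ S, SmoothEnd (T j)) : SmoothEnd (fun p => ∑ j ∈ S, T j p) := by
  classical
  induction S using Finset.induction_on with
  | empty => simpa using smoothEnd_const 0
  | insert a S ha ih =>
    simp only [Finset.sum_insert ha]
    exact (h a (by simp)).add (ih fun j hj => h j (by simp [hj]))

theorem SmoothEnd.diffAt [IsManifold 𝓘(ℂ) ω M] {f : M → End n} (hf : SmoothEnd f)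
    {e : OpenPartialHomeomorph M ℂ} (he : IsCoord e) {p : M} (hp : p ∈ e.source) : DiffAt e f p :=
  differentiableAt_coord hf he (e.map_source hp)

theorem SmoothEnd.apply {f : M → End n} (hf : SmoothEnd f) (w : Cn n) :
    ContMDiff 𝓘(ℝ, ℂ) 𝓘(ℝ, Cn n) ∞ (fun p => f p w) :=
  ((ContinuousLinearMap.apply ℂ (Cn n) w).restrictScalars ℝ).contMDiff.comp hf

theorem cartan_eq (V : Submodule ℂ (Cn n)) :
    (cartan V : End n) = (proj V + proj V) - 1 := by
  change proj V - proj Vᗮ = _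
  rw [proj_orthogonal]
  abel

theorem isSubbundle_iff {W : M → Submodule ℂ (Cn n)} :
    IsSubbundle W ↔ SmoothEnd fun p => proj (W p) := by
  constructor
  · intro h
    have h2 := ((smoothEnd_const ((1 / 2 : ℂ) • (1 : End n))).mul
      ((show SmoothEnd fun p => (cartan (W p) : End n) from h).add (smoothEnd_const 1)))
    convert h2 using 2 with p
    rw [cartan_eq, sub_add_cancel, smul_mul_assoc, one_mul]
    module
  · intro h
    have h2 := (h.add h).sub (smoothEnd_const 1)
    unfold IsSubbundle
    simp only [cartan_eq]
    exact h2

theorem finrank_eq_trace (V : Submodule ℂ (Cn n)) :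
    (Module.finrank ℂ V : ℂ) = LinearMap.trace ℂ (Cn n) (proj V : Cn n →ₗ[ℂ] Cn n) := by
  refine (LinearMap.IsProj.trace (p := V) ⟨fun x => proj_mem V x, fun x hx => ?_⟩).symm
  exact proj_apply_eq_self_iff.2 hx

/-- Subbundles have constant rank. -/
theorem finrank_constant [ConnectedSpace M] {W : M → Submodule ℂ (Cn n)}
    (hW : SmoothEnd fun p => proj (W p)) (p q : M) :
    Module.finrank ℂ (W p) = Module.finrank ℂ (W q) := by
  -- The rank is the trace of the projection: continuous and integer valued, hence constant on a
  -- connected space.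
  let L : End n →ₗ[ℂ] ℂ :=
    LinearMap.trace ℂ (Cn n) ∘ₗ ContinuousLinearMap.coeLM ℂ
  have hL : Continuous L := L.continuous_of_finiteDimensional
  have h1 : Continuous fun p => (L (proj (W p))).re :=
    Complex.continuous_re.comp (hL.comp (ContMDiff.continuous hW))
  have h2 : (fun p => (L (proj (W p))).re) = fun p => ((Module.finrank ℂ (W p) : ℕ) : ℝ) := by
    funext p
    have : L (proj (W p)) = (Module.finrank ℂ (W p) : ℂ) := (finrank_eq_trace (W p)).symm
    rw [this, Complex.natCast_re]
  rw [h2] at h1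
  have h3 : Continuous fun p => Module.finrank ℂ (W p) :=
    Nat.isClosedEmbedding_coe_real.isInducing.continuous_iff.2 h1
  exact PreconnectedSpace.constant inferInstance h3

end Smooth

theorem star_sum_end {n : ℕ} {ι : Type*} (S : Finset ι) (T : ι → End n) :
    star (∑ j ∈ S, T j) = ∑ j ∈ S, star (T j) := by
  simp only [ContinuousLinearMap.star_eq_adjoint, map_sum]

theorem mul_mul_eq_neg_of_mul_eq_neg {R : Type*} [Ring R] {x y a b : R} (hx : x * x = x)
    (hy : y * y = y) (h : x * b = -(a * y)) : x * a * y = -(x * b * y) := by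
  have : x * (x * b) * y = -(x * a * (y * y)) := by rw [h]; noncomm_ring
  rw [← mul_assoc, hx, hy] at this
  rw [this, neg_neg]

/-! ### Frames of projections and the edge relation -/

section Frames

variable {M : Type*} [TopologicalSpace M] [ChartedSpace ℂ M] {n : ℕ}

/-- Smooth families of mutually orthogonal projections with sum `1`. -/
structure IsFrame {ι : Type*} (N : Finset ι) (T : ι → M → End n) : Prop where
  smooth : ∀ j ∈ N, SmoothEnd (T j)
  star_eq : ∀ j ∈ N, ∀ p, star (T j p) = T j p
  idem : ∀ j ∈ N, ∀ p, T j p * T j p = T j p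
  orth : ∀ j ∈ N, ∀ k ∈ N, j ≠ k → ∀ p, T j p * T k p = 0
  sum_eq : ∀ p, ∑ j ∈ N, T j p = 1

/-- `A'_{a,b}` does not vanish identically, where `a` and `b` are the images of the projections
`S` and `T`. -/
def IsEdge (S T : M → End n) : Prop :=
  ∃ e : OpenPartialHomeomorph M ℂ, IsCoord e ∧ ∃ p ∈ e.source, T p * dz e S p * S p ≠ 0

/-- The family of the sums of a frame over the fibres of `f`. -/
def fibreSum {ι κ : Type*} [DecidableEq κ] (N : Finset ι) (T : ι → M → End n) (f : ι → κ) (k : κ)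
    (p : M) : End n :=
  ∑ j ∈ N with f j = k, T j p

namespace IsFrame

variable {ι : Type*} {N : Finset ι} {T : ι → M → End n}

theorem sum_mul (h : IsFrame N T) {S : Finset ι} (hS : S ⊆ N) {k : ι} (hk : k ∈ S) (p : M) :
    (∑ j ∈ S, T j p) * T k p = T k p := by
  rw [Finset.sum_mul, Finset.sum_eq_single_of_mem k hk, h.idem k (hS hk)]
  exact fun j hj hjk => h.orth j (hS hj) k (hS hk) hjk p

theorem sum_mul_zero (h : IsFrame N T) {S : Finset ι} (hS : S ⊆ N) {k : ι} (hk : k ∈ N)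
    (hkS : k ∉ S) (p : M) : (∑ j ∈ S, T j p) * T k p = 0 := by
  rw [Finset.sum_mul]
  refine Finset.sum_eq_zero fun j hj => h.orth j (hS hj) k hk (fun hjk => hkS (hjk ▸ hj)) p

theorem star_sum (h : IsFrame N T) {S : Finset ι} (hS : S ⊆ N) (p : M) :
    star (∑ j ∈ S, T j p) = ∑ j ∈ S, T j p := by
  rw [star_sum_end]
  exact Finset.sum_congr rfl fun j hj => h.star_eq j (hS hj) p

theorem sum_idem (h : IsFrame N T) {S : Finset ι} (hS : S ⊆ N) (p : M) :
    (∑ j ∈ S, T j p) * (∑ j ∈ S, T j p) = ∑ j ∈ S, T j p := by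
  conv_lhs => rw [Finset.mul_sum]
  exact Finset.sum_congr rfl fun j hj => h.sum_mul hS hj p

theorem fibreSum {κ : Type*} [DecidableEq κ] {K : Finset κ} (h : IsFrame N T) {f : ι → κ}
    (hf : ∀ j ∈ N, f j ∈ K) : IsFrame K (fibreSum N T f) where
  smooth k _ := SmoothEnd.sum fun j hj => h.smooth j (Finset.mem_filter.1 hj).1
  star_eq k _ p := h.star_sum (Finset.filter_subset _ _) p
  idem k _ p := h.sum_idem (Finset.filter_subset _ _) p
  orth k _ l _ hkl p := by
    simp only [TwistorLift.fibreSum]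
    rw [Finset.mul_sum]
    refine Finset.sum_eq_zero fun j hj => ?_
    obtain ⟨hjN, rfl⟩ := Finset.mem_filter.1 hj
    exact h.sum_mul_zero (Finset.filter_subset _ _) hjN (by simp [hkl.symm]) p
  sum_eq p := by
    simp only [TwistorLift.fibreSum]
    rw [Finset.sum_fiberwise_of_maps_to hf]
    exact h.sum_eq p

theorem subset (h : IsFrame N T) {S : Finset ι} (hS : S ⊆ N)
    (h0 : ∀ j ∈ N, j ∉ S → ∀ p, T j p = 0) : IsFrame S T where
  smooth j hj := h.smooth j (hS hj)
  star_eq j hj := h.star_eq j (hS hj)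
  idem j hj := h.idem j (hS hj)
  orth j hj k hk := h.orth j (hS hj) k (hS hk)
  sum_eq p := by
    rw [← h.sum_eq p]
    exact Finset.sum_subset hS fun j hj hjS => h0 j hj hjS p

variable [IsManifold 𝓘(ℂ) ω M] {e : OpenPartialHomeomorph M ℂ} {p : M}

theorem mul_dz (h : IsFrame N T) (he : IsCoord e) (hp : p ∈ e.source) {j k : ι} (hj : j ∈ N)
    (hk : k ∈ N) (hjk : j ≠ k) : T j p * dz e (T k) p = -(dz e (T j) p * T k p) := by
  have h1 := dz_mul hp ((h.smooth j hj).diffAt he hp) ((h.smooth k hk).diffAt he hp)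
  have h2 : (fun q => T j q * T k q) = fun _ => 0 := funext (h.orth j hj k hk hjk)
  rw [h2, dz_const] at h1
  exact (neg_eq_of_add_eq_zero_right h1.symm).symm

/-- Differentiating `T j * T k = 0` moves the derivative from one projection to the other at the
cost of a sign. -/
theorem mul_dz_mul (h : IsFrame N T) (he : IsCoord e) (hp : p ∈ e.source) {j k : ι} (hj : j ∈ N)
    (hk : k ∈ N) (hjk : j ≠ k) :
    T j p * dz e (T j) p * T k p = -(T j p * dz e (T k) p * T k p) :=
  mul_mul_eq_neg_of_mul_eq_neg (h.idem j hj p) (h.idem k hk p) (h.mul_dz he hp hj hk hjk)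

/-- A' is tensorial and additive, so its component between two sums of pieces is the sum of the
components between the pieces. -/
theorem not_isEdge_fibreSum {κ : Type*} [DecidableEq κ] (h : IsFrame N T) {f : ι → κ}
    {k l : κ} (hkl : k ≠ l)
    (hE : ∀ a ∈ N, ∀ b ∈ N, IsEdge (T a) (T b) → f a = k → f b ≠ l) :
    ¬ IsEdge (TwistorLift.fibreSum N T f k) (TwistorLift.fibreSum N T f l) := by
  rintro ⟨e, he, p, hp, hne⟩
  refine hne ?_
  have hs : ∀ k, SmoothEnd (TwistorLift.fibreSum N T f k) := fun k =>
    SmoothEnd.sum fun j hj => h.smooth j (Finset.mem_filter.1 hj).1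
  have hlk : ∀ q, TwistorLift.fibreSum N T f l q * TwistorLift.fibreSum N T f k q = 0 := by
    intro q
    simp only [TwistorLift.fibreSum]
    rw [Finset.mul_sum]
    refine Finset.sum_eq_zero fun j hj => ?_
    obtain ⟨hjN, rfl⟩ := Finset.mem_filter.1 hj
    exact h.sum_mul_zero (Finset.filter_subset _ _) hjN (by simp [hkl]) q
  conv_lhs => rw [TwistorLift.fibreSum.eq_1 N T f k p]
  rw [Finset.mul_sum]
  refine Finset.sum_eq_zero fun c hc => ?_
  have hc' := Finset.mem_filter.1 hc
  -- Differentiate `T c = S_k * T c`, with S_k the sum over the fibre of `k`. The term beginning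
  -- with S_k dies under S_l, so on the range of `T c` the derivative of S_k may be replaced by that
  -- of `T c`.
  have h1 := dz_mul hp ((hs k).diffAt he hp) ((h.smooth c hc'.1).diffAt he hp)
  have h2 : (fun q => TwistorLift.fibreSum N T f k q * T c q) = T c :=
    funext fun q => h.sum_mul (Finset.filter_subset _ _) hc q
  rw [h2] at h1
  have h3 := congrArg (fun x => TwistorLift.fibreSum N T f l p * x) h1
  simp only [mul_add] at h3
  rw [← mul_assoc, ← mul_assoc, hlk, zero_mul, add_zero] at h3
  have h4 : TwistorLift.fibreSum N T f l p * dz e (TwistorLift.fibreSum N T f k) p * T c p =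
      TwistorLift.fibreSum N T f l p * dz e (T c) p * T c p := by
    rw [h3, mul_assoc _ (T c p), h.idem c hc'.1]
  rw [h4, TwistorLift.fibreSum.eq_1 N T f l p, Finset.sum_mul, Finset.sum_mul]
  refine Finset.sum_eq_zero fun b hb => ?_
  have hb' := Finset.mem_filter.1 hb
  by_contra hcon
  exact hE c hc'.1 b hb'.1 ⟨e, he, p, hp, hcon⟩ hc'.2 hb'.2

end IsFrame

end Frames

section Legs

variable {n : ℕ}

/-- The projection onto the sum of mutually orthogonal subspaces. -/
theorem proj_iSup {ι : Type*} {S : Finset ι} {V : ι → Submodule ℂ (Cn n)}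
    (h : ∀ j ∈ S, ∀ k ∈ S, j ≠ k → V j ⟂ V k) :
    proj (⨆ j ∈ S, V j) = ∑ j ∈ S, proj (V j) := by
  have hsum : ∀ k ∈ S, (∑ j ∈ S, proj (V j)) * proj (V k) = proj (V k) := by
    intro k hk
    rw [Finset.sum_mul, Finset.sum_eq_single_of_mem k hk, proj_mul_self]
    exact fun j hj hjk => proj_mul_proj_of_isOrtho (h j hj k hk hjk)
  refine eq_proj ?_ ?_ fun x => ⟨fun hx => ?_, fun hx => ?_⟩
  · conv_lhs => rw [Finset.mul_sum]
    exact Finset.sum_congr rfl hsum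
  · rw [star_sum_end]
    exact Finset.sum_congr rfl fun j _ => star_proj _
  · rw [← hx, sum_apply]
    refine Submodule.sum_mem _ fun j hj => ?_
    exact Submodule.mem_iSup_of_mem j (Submodule.mem_iSup_of_mem hj (proj_mem _ _))
  · have : (⨆ j ∈ S, V j) ≤
        LinearMap.eqLocus ((∑ j ∈ S, proj (V j) : End n) : Cn n →ₗ[ℂ] Cn n) LinearMap.id := by
      refine iSup₂_le fun k hk y hy => ?_
      change (∑ j ∈ S, proj (V j) : End n) y = y
      have := congrArg (fun f : End n => f y) (hsum k hk)
      change (∑ j ∈ S, proj (V j) : End n) (proj (V k) y) = proj (V k) y at this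
      rwa [proj_apply_eq_self_iff.2 hy] at this
    exact this hx

end Legs

/-! ### Block decomposition of a tangent vector -/

section Algebra

/-- The hypothesis on `y` is the Leibniz rule for `r i * r i = r i`. It kills every block outside
row and column `i`, and makes the diagonal block equal to twice itself, hence zero. -/
theorem eq_sum_of_eq_mul_add_mul {R : Type*} [Ring R] {ι : Type*} [Fintype ι] [DecidableEq ι]
    {r : ι → R} (hr : ∑ j, r j = 1) {i : ι} (hi : r i * r i = r i) {y : R}
    (hy : y = y * r i + r i * y) :
    y = ∑ j ∈ Finset.univ.erase i, (r j * y * r i + r i * y * r j) := by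
  have h0 : r i * y * r i = 0 := by
    have h1 : r i * y * r i = r i * y * (r i * r i) + (r i * r i) * y * r i := by
      conv_lhs => rw [hy]
      noncomm_ring
    rw [hi] at h1
    exact left_eq_add.1 h1
  have h2 : ∑ j, (r j * y * r i + r i * y * r j) = y := by
    rw [Finset.sum_add_distrib, ← Finset.mul_sum, hr, mul_one]
    simp_rw [mul_assoc]
    rw [← Finset.sum_mul, hr, one_mul, ← hy]
  rw [← Finset.add_sum_erase _ _ (Finset.mem_univ i), h0, add_zero, zero_add] at h2
  exact h2.symm

/-- Only `y * a * x`, with coefficient `v`, and `x * b * y`, with coefficient the conjugate of `v`,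
survive. Passing from `v` to `I * v` multiplies them by `I` and `-I`, whence the minus sign between
the blocks in `Flag.J2`. -/
theorem type_one_zero_component {A : Type*} [Ring A] [Algebra ℂ A] {x y a b : A} (v : ℂ)
    (h1 : y * b * x = 0) (h2 : x * a * y = 0) :
    y * ((Complex.I * v) • a + (starRingEnd ℂ (Complex.I * v)) • b) * x +
      x * ((Complex.I * v) • a + (starRingEnd ℂ (Complex.I * v)) • b) * y =
    Complex.I • (y * (v • a + (starRingEnd ℂ v) • b) * x -
      x * (v • a + (starRingEnd ℂ v) • b) * y) := by
  simp only [mul_add, add_mul, mul_smul_comm, smul_mul_assoc, h1, h2, smul_zero, map_mul,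
    Complex.conj_I]
  module

theorem type_zero_one_component {A : Type*} [Ring A] [Algebra ℂ A] {x y a b : A} (v : ℂ)
    (h1 : y * a * x = 0) (h2 : x * b * y = 0) :
    y * ((Complex.I * v) • a + (starRingEnd ℂ (Complex.I * v)) • b) * x +
      x * ((Complex.I * v) • a + (starRingEnd ℂ (Complex.I * v)) • b) * y =
    (-Complex.I) • (y * (v • a + (starRingEnd ℂ v) • b) * x -
      x * (v • a + (starRingEnd ℂ v) • b) * y) := by
  simp only [mul_add, add_mul, mul_smul_comm, smul_mul_assoc, h1, h2, smul_zero, map_mul,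
    Complex.conj_I]
  module

theorem star_mul_mul_star_eq_zero {R : Type*} [Ring R] [StarRing R] {x y a : R}
    (h : x * a * y = 0) : star y * star a * star x = 0 := by
  have := congrArg star h
  rwa [star_mul, star_mul, star_zero, ← mul_assoc] at this

end Algebra

/-! ### The criterion for J₂-holomorphicity -/

section Holomorphic

variable {M : Type*} [TopologicalSpace M] [ChartedSpace ℂ M] [IsManifold 𝓘(ℂ) ω M] {n s : ℕ}
  {d : Fin (s + 1) → ℕ}

/-- A smooth map into a flag manifold is `J₂`-holomorphic if `A'_{ψ_i, ψ_j}` vanishes unless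
`Hom(ψ_i, ψ_j)` is of type `(1,0)`. -/
theorem isJ2Holomorphic_of_isEdge {ψ : M → Flag n d}
    (h : IsFrame Finset.univ fun i p => proj ((ψ p).leg i))
    (hE : ∀ i j, i ≠ j →
      IsEdge (fun p => proj ((ψ p).leg i)) (fun p => proj ((ψ p).leg j)) →
        Flag.IsOneZero i j) :
    IsJ2Holomorphic ψ := by
  refine ⟨fun i => isSubbundle_iff.2 (h.smooth i (Finset.mem_univ i)), ?_⟩
  intro e he p hp v
  funext i
  have hdiff := fun i => (h.smooth i (Finset.mem_univ i)).diffAt he hp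
  have hstar : ∀ i q, star (proj ((ψ q).leg i)) = proj ((ψ q).leg i) := fun i q => star_proj _
  have hvan : ∀ i j, i ≠ j → ¬ Flag.IsOneZero i j →
      proj ((ψ p).leg j) * dz e (fun q => proj ((ψ q).leg i)) p * proj ((ψ p).leg i) = 0 := by
    intro i j hij h1
    by_contra hne
    exact h1 (hE i j hij ⟨e, he, p, hp, hne⟩)
  have hvan2 : ∀ i j, i ≠ j → ¬ Flag.IsOneZero i j →
      proj ((ψ p).leg i) * dzbar e (fun q => proj ((ψ q).leg i)) p * proj ((ψ p).leg j) = 0 := by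
    intro i j hij h1
    have := star_mul_mul_star_eq_zero (hvan i j hij h1)
    rwa [star_dz (hdiff i) (hstar i), hstar, hstar] at this
  have hvan3 : ∀ i j, i ≠ j → ¬ Flag.IsOneZero j i →
      proj ((ψ p).leg i) * dz e (fun q => proj ((ψ q).leg i)) p * proj ((ψ p).leg j) = 0 := by
    intro i j hij h1
    have h2 := h.mul_dz_mul he hp (Finset.mem_univ i) (Finset.mem_univ j) hij
    rw [hvan j i hij.symm h1, neg_zero] at h2
    exact h2
  have hvan4 : ∀ i j, i ≠ j → ¬ Flag.IsOneZero j i →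
      proj ((ψ p).leg j) * dzbar e (fun q => proj ((ψ q).leg i)) p * proj ((ψ p).leg i) = 0 := by
    intro i j hij h1
    have := star_mul_mul_star_eq_zero (hvan3 i j hij h1)
    rwa [star_dz (hdiff i) (hstar i), hstar, hstar] at this
  have hY : flagDiff ψ e p (Complex.I * v) i =
      flagDiff ψ e p (Complex.I * v) i * proj ((ψ p).leg i) +
        proj ((ψ p).leg i) * flagDiff ψ e p (Complex.I * v) i := by
    have h1 := diffIn_mul hp (hdiff i) (hdiff i) (Complex.I * v)
    simp only [proj_mul_self] at h1
    exact h1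
  have hsum := eq_sum_of_eq_mul_add_mul (h.sum_eq p) (i := i) (proj_mul_self _) hY
  rw [hsum]
  unfold Flag.J2
  refine Finset.sum_congr rfl fun j hj => ?_
  have hij : i ≠ j := (Finset.ne_of_mem_erase hj).symm
  unfold flagDiff
  simp only [diffIn_eq]
  -- Exactly one of Hom(ψ_i, ψ_j) and Hom(ψ_j, ψ_i) has type (1,0). The vanishing of A' in the other
  -- direction, together with its adjoint, makes the component complex linear or antilinear in `v`.
  split_ifs with hc
  · have hc' : ¬ Flag.IsOneZero j i := by
      unfold Flag.IsOneZero at hc ⊢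
      grind
    exact type_one_zero_component v (hvan4 i j hij hc') (hvan3 i j hij hc')
  · exact type_zero_one_component v (hvan i j hij hc) (hvan2 i j hij hc)

end Holomorphic

/-! ### Derivatives of a projection in block form -/

section Algebra

variable {R : Type*} [Ring R]

/-- The derivative of a projection is off-diagonal: it maps the range to the kernel and the kernel
to the range. -/
theorem mul_mul_eq_zero_of_derivation {P dP x y : R} (hd : dP = dP * P + P * dP)
    (h : (x * P = x ∧ P * y = y) ∨ (x * P = 0 ∧ P * y = 0)) : x * dP * y = 0 := by
  have h1 : x * dP * y = x * dP * (P * y) + (x * P) * dP * y := by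
    conv_lhs => rw [hd]
    noncomm_ring
  rcases h with ⟨h2, h3⟩ | ⟨h2, h3⟩
  · rw [h2, h3] at h1
    exact left_eq_add.1 h1
  · rw [h1, h2, h3, mul_zero, zero_mul, zero_mul, add_zero]

/-- The alternatives are the derivatives of `P * y = y` and of `P * y = 0`; in each, `x * dy * y`
equals `x * dP * y` up to sign. -/
theorem mul_derivation_mul_eq_zero_iff {P dP x y dy : R} (hy : y * y = y)
    (h : (x * P = 0 ∧ P * y = y ∧ dy = dP * y + P * dy) ∨
      (x * P = x ∧ P * y = 0 ∧ 0 = dP * y + P * dy)) :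
    x * dy * y = 0 ↔ x * dP * y = 0 := by
  rcases h with ⟨h1, -, h3⟩ | ⟨h1, -, h3⟩
  · have : x * dy = x * dP * y := by
      conv_lhs => rw [h3, mul_add, ← mul_assoc, ← mul_assoc, h1, zero_mul, add_zero]
    rw [this, mul_assoc, hy]
  · have : 0 = x * dP * y + x * dy := by
      have := congrArg (x * ·) h3
      simpa only [mul_zero, mul_add, ← mul_assoc, h1] using this
    rw [← neg_eq_of_add_eq_zero_right this.symm, neg_mul, neg_eq_zero, mul_assoc, hy]

theorem sub_add_mul_add_mul_one_sub (a b c P : R) :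
    a - b + (b - c) * P + (b - c) * (1 - P) = a - c := by
  noncomm_ring

end Algebra

/-! ### The pieces ψ̂_j form a frame -/

section Pieces

theorem piece_le_left {M : Type*} {n : ℕ} (φ : M → Submodule ℂ (Cn n)) (Z : ℕ → M → Submodule ℂ (Cn n)) (j : ℕ)
    (p : M) : piece φ Z j p ≤ Z (j / 2) p := fun _ h => h.1.2

theorem piece_le_right {M : Type*} {n : ℕ} (φ : M → Submodule ℂ (Cn n)) (Z : ℕ → M → Submodule ℂ (Cn n)) (j : ℕ)
    (p : M) : piece φ Z j p ≤ if Even j then φ p else (φ p)ᗮ := fun _ h => h.2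

theorem piece_isOrtho_succ {M : Type*} {n : ℕ} (φ : M → Submodule ℂ (Cn n)) (Z : ℕ → M → Submodule ℂ (Cn n)) (j : ℕ)
    (p : M) : piece φ Z j p ⟂ Z (j / 2 + 1) p := fun _ h => h.1.1

/-- `π_φ` acts on the pieces by `1` or `0`. -/
theorem proj_mul_piece {M : Type*} {n : ℕ} (φ : M → Submodule ℂ (Cn n)) (Z : ℕ → M → Submodule ℂ (Cn n)) (j : ℕ)
    (p : M) : proj (φ p) * proj (piece φ Z j p) =
      if j % 2 = 0 then proj (piece φ Z j p) else 0 := by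
  have h := piece_le_right φ Z j p
  split_ifs with hj
  · rw [if_pos (Nat.even_iff.2 hj)] at h
    exact proj_mul_proj_of_le h
  · rw [if_neg (by rwa [Nat.even_iff])] at h
    exact proj_mul_proj_of_isOrtho ((Submodule.isOrtho_orthogonal_right _).mono_right h)

theorem piece_mul_proj {M : Type*} {n : ℕ} (φ : M → Submodule ℂ (Cn n)) (Z : ℕ → M → Submodule ℂ (Cn n)) (j : ℕ)
    (p : M) : proj (piece φ Z j p) * proj (φ p) =
      if j % 2 = 0 then proj (piece φ Z j p) else 0 := by
  have h := congrArg star (proj_mul_piece φ Z j p)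
  rw [star_mul, star_proj, star_proj] at h
  rw [h]
  split_ifs
  · exact star_proj _
  · exact star_zero (End n)

end Pieces

section Filtration

variable {M : Type*} [TopologicalSpace M] [ChartedSpace ℂ M] {n : ℕ}
  {φ : M → Submodule ℂ (Cn n)} {t : ℕ} {Z : ℕ → M → Submodule ℂ (Cn n)}

theorem IsAzFiltration.antitone {Φ : M → unitary (End n)} (hZ : IsAzFiltration Φ t Z) {i k : ℕ}
    (hik : i ≤ k) (hk : k ≤ t + 1) (p : M) : Z k p ≤ Z i p := by
  induction k, hik using Nat.le_induction with
  | base => exact le_rfl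
  | succ k _ ih => exact (hZ.anti k (by omega) p).trans (ih (by omega))

theorem piece_isOrtho_of_lt {Φ : M → unitary (End n)} (hZ : IsAzFiltration Φ t Z) {j k : ℕ}
    (hjk : j / 2 < k) (hk : k ≤ t + 1) (p : M) : piece φ Z j p ⟂ Z k p :=
  (piece_isOrtho_succ φ Z j p).mono_right (hZ.antitone hjk hk p)

theorem piece_isOrtho {Φ : M → unitary (End n)} (hZ : IsAzFiltration Φ t Z) {j k : ℕ}
    (hj : j < 2 * t + 2) (hk : k < 2 * t + 2) (hjk : j ≠ k) (p : M) :
    piece φ Z j p ⟂ piece φ Z k p := by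
  rcases lt_trichotomy (j / 2) (k / 2) with h | h | h
  · exact (piece_isOrtho_of_lt hZ h (by omega) p).mono_right (piece_le_left φ Z k p)
  · have h1 := piece_le_right φ Z j p
    have h2 := piece_le_right φ Z k p
    rcases Nat.even_or_odd j with hj' | hj'
    · have hk' : ¬ Even k := by grind
      rw [if_pos hj'] at h1
      rw [if_neg hk'] at h2
      exact (Submodule.isOrtho_orthogonal_right _).mono h1 h2
    · have hk' : Even k := by grind
      rw [if_neg (Nat.not_even_iff_odd.2 hj')] at h1
      rw [if_pos hk'] at h2
      exact (Submodule.isOrtho_orthogonal_left _).mono h1 h2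
  · exact ((piece_isOrtho_of_lt hZ h (by omega) p).mono_right (piece_le_left φ Z j p)).symm

theorem proj_piece {Φ : M → unitary (End n)} (hZ : IsAzFiltration Φ t Z) (hsplit : Splits φ t Z)
    {j : ℕ} (hj : j < 2 * t + 2) (p : M) :
    proj (piece φ Z j p) = (proj (Z (j / 2) p) - proj (Z (j / 2 + 1) p)) *
      (if Even j then proj (φ p) else 1 - proj (φ p)) := by
  have hc : ∀ i ≤ t + 1, proj (Z i p) * proj (φ p) = proj (φ p) * proj (Z i p) :=
    fun i hi => commute_proj_of_split (hsplit i hi p)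
  have hc' : ∀ i ≤ t + 1, proj (Z i p) * proj (φ p)ᗮ = proj (φ p)ᗮ * proj (Z i p) := by
    intro i hi
    rw [proj_orthogonal]
    exact (Commute.sub_right (Commute.one_right _) (hc i hi)).eq
  have hle := hZ.anti (j / 2) (by omega) p
  unfold piece filtLeg
  split_ifs
  · exact proj_orthogonal_inf_inf hle (hc _ (by omega)) (hc _ (by omega))
  · rw [proj_orthogonal_inf_inf hle (hc' _ (by omega)) (hc' _ (by omega)), proj_orthogonal]

theorem isFrame_piece {Φ : M → unitary (End n)} (hφ : IsSubbundle φ) (hZ : IsAzFiltration Φ t Z)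
    (hsplit : Splits φ t Z) :
    IsFrame (Finset.range (2 * t + 2)) fun j p => proj (piece φ Z j p) where
  smooth j hj := by
    have hj := Finset.mem_range.1 hj
    have hs : ∀ i ≤ t + 1, SmoothEnd fun p => proj (Z i p) :=
      fun i hi => isSubbundle_iff.1 (hZ.hol i hi).1
    have hs' := isSubbundle_iff.1 hφ
    simp only [proj_piece hZ hsplit hj]
    refine ((hs _ (by omega)).sub (hs _ (by omega))).mul ?_
    split_ifs
    · exact hs'
    · exact (smoothEnd_const 1).sub hs'
  star_eq j _ p := star_proj _
  idem j _ p := proj_mul_self _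
  orth j hj k hk hjk p := proj_mul_proj_of_isOrtho
    (piece_isOrtho hZ (Finset.mem_range.1 hj) (Finset.mem_range.1 hk) hjk p)
  sum_eq p := by
    -- The pieces `2 * i` and `2 * i + 1` add up to the leg Z_i ⊖ Z_{i+1}, so the sum telescopes.
    have key : ∀ k ≤ t + 1, ∑ j ∈ Finset.range (2 * k), proj (piece φ Z j p) =
        proj (Z 0 p) - proj (Z k p) := by
      intro k
      induction k with
      | zero => simp
      | succ k ih =>
        intro hk
        rw [show 2 * (k + 1) = 2 * k + 1 + 1 by ring, Finset.sum_range_succ,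
          Finset.sum_range_succ, ih (by omega), proj_piece hZ hsplit (by omega),
          proj_piece hZ hsplit (by omega), if_pos (by simp), if_neg (by simp),
          show 2 * k / 2 = k by omega, show (2 * k + 1) / 2 = k by omega]
        exact sub_add_mul_add_mul_one_sub _ _ _ _
    have h := key (t + 1) le_rfl
    have h0 : proj (Z 0 p) = 1 := by
      rw [hZ.top]; ext1 x; exact proj_apply_eq_self_iff.2 trivial
    have h1 : proj (Z (t + 1) p) = 0 := by
      rw [hZ.bot]; ext1 x; exact (Submodule.mem_bot ℂ).1 (proj_mem _ _)
    rw [show 2 * t + 2 = 2 * (t + 1) by ring, h, h0, h1, sub_zero]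

end Filtration

theorem piece_mul_proj_cases {M : Type*} {n : ℕ} (φ : M → Submodule ℂ (Cn n)) (Z : ℕ → M → Submodule ℂ (Cn n))
    (j : ℕ) (p : M) : proj (piece φ Z j p) * proj (φ p) = proj (piece φ Z j p) ∨
      proj (piece φ Z j p) * proj (φ p) = 0 := by
  rw [piece_mul_proj]
  split_ifs <;> simp

/-! ### Edges between pieces and the filtration index -/

section Edges

variable {M : Type*} [TopologicalSpace M] [ChartedSpace ℂ M] [IsManifold 𝓘(ℂ) ω M] {n : ℕ}
  {φ : M → Submodule ℂ (Cn n)} {t : ℕ} {Z : ℕ → M → Submodule ℂ (Cn n)}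
  {e : OpenPartialHomeomorph M ℂ} {p : M}

theorem half_smul_add_self (a : End n) : (1 / 2 : ℂ) • (a + a) = a := by module

theorem inv_cartan (V : Submodule ℂ (Cn n)) :
    (((cartan V)⁻¹ : unitary (End n)) : End n) = (proj V + proj V) - 1 := by
  have h : (((cartan V)⁻¹ : unitary (End n)) : End n) = star (proj V - proj Vᗮ) := rfl
  rw [h, ← cartan_eq]
  have h2 : star (proj V - proj Vᗮ) = star (proj V) - star (proj Vᗮ) := by
    simp only [ContinuousLinearMap.star_eq_adjoint, map_sub]
  rw [h2, star_proj, star_proj]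
  rfl

/-- The Cartan image 2π_φ - 1 is a self-adjoint involution, so it is its own inverse; the 2 in its
derivative cancels the 1/2. -/
theorem Az_eq (hφ : IsSubbundle φ) (he : IsCoord e) (hp : p ∈ e.source) :
    Az (fun q => cartan (φ q)) e p =
      ((proj (φ p) + proj (φ p)) - 1) * dz e (fun q => proj (φ q)) p := by
  have hP := isSubbundle_iff.1 hφ
  have h1 := dz_sub (p := p) ((hP.add hP).diffAt he hp) ((smoothEnd_const 1).diffAt he hp)
  have h2 : dz e (fun q => proj (φ q) + proj (φ q)) p =
      dz e (fun q => proj (φ q)) p + dz e (fun q => proj (φ q)) p := by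
    have h3 := dz_sub (p := p) ((hP.add hP).diffAt he hp) (hP.diffAt he hp)
    simp only [add_sub_cancel_right] at h3
    exact (eq_sub_iff_add_eq.1 h3).symm
  unfold Az
  rw [inv_cartan]
  simp only [cartan_eq]
  rw [h1, h2, dz_const, sub_zero, ← mul_smul_comm, half_smul_add_self]

theorem Azbar_eq (hφ : IsSubbundle φ) (he : IsCoord e) (hp : p ∈ e.source) :
    Azbar (fun q => cartan (φ q)) e p =
      ((proj (φ p) + proj (φ p)) - 1) * dzbar e (fun q => proj (φ q)) p := by
  have hP := isSubbundle_iff.1 hφ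
  have h1 := dzbar_sub (p := p) ((hP.add hP).diffAt he hp) ((smoothEnd_const 1).diffAt he hp)
  have h2 : dzbar e (fun q => proj (φ q) + proj (φ q)) p =
      dzbar e (fun q => proj (φ q)) p + dzbar e (fun q => proj (φ q)) p := by
    have h3 := dzbar_sub (p := p) ((hP.add hP).diffAt he hp) (hP.diffAt he hp)
    simp only [add_sub_cancel_right] at h3
    exact (eq_sub_iff_add_eq.1 h3).symm
  unfold Azbar
  rw [inv_cartan]
  simp only [cartan_eq]
  rw [h1, h2, dzbar_const, sub_zero, ← mul_smul_comm, half_smul_add_self]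

/-- The reflection `P + P - 1` acts on `x` from the right by 1 or -1, so the factor φ⁻¹ in A^φ does
not affect which blocks vanish. -/
theorem mul_reflection_eq_zero_iff {R : Type*} [Ring R] {x P y : R}
    (h : x * P = x ∨ x * P = 0) : x * ((P + P) - 1) * y = 0 ↔ x * y = 0 := by
  rcases h with h | h
  · rw [mul_sub, mul_add, h, mul_one, add_sub_cancel_right]
  · rw [mul_sub, mul_add, h, mul_one, add_zero, zero_sub, neg_mul, neg_eq_zero]

/-- Between pieces of different type, `A'` is given by the derivative of `π_φ`. -/
theorem piece_dz_piece_eq_zero_iff (hφ : IsSubbundle φ) (he : IsCoord e) (hp : p ∈ e.source)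
    {a b : ℕ} (ha : SmoothEnd fun q => proj (piece φ Z a q)) (hab : a % 2 ≠ b % 2) :
    proj (piece φ Z b p) * dz e (fun q => proj (piece φ Z a q)) p * proj (piece φ Z a p) = 0 ↔
      proj (piece φ Z b p) * dz e (fun q => proj (φ q)) p * proj (piece φ Z a p) = 0 := by
  have h1 := dz_mul hp ((isSubbundle_iff.1 hφ).diffAt he hp) (ha.diffAt he hp)
  have h2 := proj_mul_piece φ Z a
  have h3 := piece_mul_proj φ Z b p
  refine mul_derivation_mul_eq_zero_iff (P := proj (φ p)) (proj_mul_self _) ?_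
  rcases Nat.mod_two_eq_zero_or_one a with ha0 | ha1
  · refine Or.inl ⟨?_, ?_, ?_⟩
    · rw [h3, if_neg (by omega)]
    · rw [h2, if_pos ha0]
    · rw [← h1]; simp only [h2, if_pos ha0]
  · refine Or.inr ⟨?_, ?_, ?_⟩
    · rw [h3, if_pos (by omega)]
    · rw [h2, if_neg (by omega)]
    · rw [← h1]; simp only [h2, if_neg (show ¬ a % 2 = 0 by omega), dz_const]

/-- Across parities A' is, up to sign, a block of A^φ_z. This maps ψ̂_a into Z_{a/2+1}, which is
orthogonal to ψ̂_b when b/2 ≤ a/2. -/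
theorem isEdge_cross (hφ : IsSubbundle φ) (hZ : IsAzFiltration (fun p => cartan (φ p)) t Z)
    (hsplit : Splits φ t Z) {a b : ℕ} (ha : a < 2 * t + 2)
    (hab : a % 2 ≠ b % 2)
    (hE : IsEdge (fun p => proj (piece φ Z a p)) (fun p => proj (piece φ Z b p))) :
    a / 2 < b / 2 := by
  by_contra hcon
  obtain ⟨e, he, p, hp, hne⟩ := hE
  refine hne ?_
  have hF := isFrame_piece hφ hZ hsplit
  refine (piece_dz_piece_eq_zero_iff hφ he hp (hF.smooth a (Finset.mem_range.2 ha)) hab).2 ?_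
  rw [mul_assoc, ← mul_reflection_eq_zero_iff (piece_mul_proj_cases φ Z b p), mul_assoc,
    ← mul_assoc _ (dz e _ p)]
  ext1 w
  have h1 := hZ.maps (a / 2) (by omega) e he p hp (proj (piece φ Z a p) w)
    (piece_le_left φ Z a p (proj_mem _ _))
  rw [Az_eq hφ he hp] at h1
  exact proj_apply_eq_zero_of_isOrtho
    (piece_isOrtho_of_lt hZ (show b / 2 < a / 2 + 1 by omega) (by omega) p) h1

/-- Suppose a/2 < b/2. Then ψ̂_b lies in Z_{b/2}, which D^φ_z̄ preserves and to which ψ̂_a is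
orthogonal. As A^φ_z̄ has no block between equal parities, ∂_z̄ has no component from ψ̂_b to ψ̂_a;
the adjoint statement is that A' from ψ̂_a to ψ̂_b vanishes. -/
theorem isEdge_same (hφ : IsSubbundle φ) (hZ : IsAzFiltration (fun p => cartan (φ p)) t Z)
    (hsplit : Splits φ t Z) {a b : ℕ} (ha : a < 2 * t + 2) (hb : b < 2 * t + 2)
    (hab : a % 2 = b % 2)
    (hE : IsEdge (fun p => proj (piece φ Z a p)) (fun p => proj (piece φ Z b p))) :
    b / 2 ≤ a / 2 := by
  by_contra hcon
  have hne' : b ≠ a := by omega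
  obtain ⟨e, he, p, hp, hne⟩ := hE
  refine hne ?_
  have hF := isFrame_piece hφ hZ hsplit
  have hP := isSubbundle_iff.1 hφ
  have hQ := isSubbundle_iff.1 (hZ.hol (b / 2) (by omega)).1
  have haN := Finset.mem_range.2 ha
  have hbN := Finset.mem_range.2 hb
  have hort := piece_isOrtho_of_lt (φ := φ) hZ (show a / 2 < b / 2 by omega) (by omega) p
  have hTQ := proj_mul_proj_of_isOrtho hort
  have hle := piece_le_left φ Z b
  have hPd : proj (piece φ Z a p) * dzbar e (fun q => proj (φ q)) p * proj (piece φ Z b p) = 0 := by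
    have h1 := dzbar_mul hp (hP.diffAt he hp) (hP.diffAt he hp)
    simp only [proj_mul_self] at h1
    refine mul_mul_eq_zero_of_derivation h1 ?_
    rw [proj_mul_piece, piece_mul_proj, hab]
    split_ifs <;> simp
  have hQd : proj (piece φ Z a p) *
      (dzbar e (fun q => proj (Z (b / 2) q)) p * proj (piece φ Z b p)) = 0 := by
    ext1 u
    -- A smooth section of Z_{b/2} that takes at `p` an arbitrary value in the piece `b`.
    have hs : IsSectionOn (Z (b / 2)) e.source
        (fun q => proj (Z (b / 2) q) (proj (piece φ Z b p) u)) :=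
      ⟨(hQ.apply _).contMDiffOn, fun q _ => proj_mem _ _⟩
    have h1 := (hZ.hol (b / 2) (by omega)).2 e he _ hs p hp
    rw [dzbar_apply (hQ.diffAt he hp), proj_apply_eq_self_iff.2 (hle p (proj_mem _ _)),
      Azbar_eq hφ he hp] at h1
    have h5 := proj_apply_eq_zero_of_isOrtho hort h1
    rw [mul_assoc, ← mul_reflection_eq_zero_iff (piece_mul_proj_cases φ Z a p), mul_assoc,
      ← mul_assoc _ (dzbar e _ p)] at hPd
    have h6 : proj (piece φ Z a p) ((((proj (φ p) + proj (φ p)) - 1) *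
          dzbar e (fun q => proj (φ q)) p) (proj (piece φ Z b p) u)) = 0 :=
      congrArg (fun f : End n => f u) hPd
    rw [map_add, h6, add_zero] at h5
    exact h5
  have h1 := dzbar_mul hp (hQ.diffAt he hp) ((hF.smooth b hbN).diffAt he hp)
  have h2 : (fun q => proj (Z (b / 2) q) * proj (piece φ Z b q)) =
      fun q => proj (piece φ Z b q) := funext fun q => proj_mul_proj_of_le (hle q)
  rw [h2] at h1
  have h3 : proj (piece φ Z a p) * dzbar e (fun q => proj (piece φ Z b q)) p *
      proj (piece φ Z b p) = 0 := by
    rw [h1, mul_add, hQd, ← mul_assoc, hTQ, zero_mul, add_zero, zero_mul]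
  have h4 := star_mul_mul_star_eq_zero h3
  rw [star_proj, star_proj, star_dzbar ((hF.smooth b hbN).diffAt he hp) fun q => star_proj _] at h4
  have h5 := hF.mul_dz_mul he hp hbN haN hne'
  exact neg_eq_zero.1 (h5.symm.trans h4)

/-- A smooth map whose derivatives `∂_z` and `∂_z̄` vanish is constant. -/
theorem constant_of_dz_eq_zero [ConnectedSpace M] {f : M → End n} (hf : SmoothEnd f)
    (hs : ∀ q, star (f q) = f q)
    (h : ∀ e : OpenPartialHomeomorph M ℂ, IsCoord e → ∀ p ∈ e.source, dz e f p = 0) (p q : M) :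
    f p = f q := by
  refine IsLocallyConstant.apply_eq_of_preconnectedSpace ?_ p q
  rw [IsLocallyConstant.iff_eventually_eq]
  intro x
  set e := chartAt ℂ x
  have he : IsCoord e := isCoord_chartAt x
  have hx : x ∈ e.source := mem_chart_source ℂ x
  obtain ⟨r, hr, hball⟩ := Metric.isOpen_iff.1 e.open_target (e x) (e.map_source hx)
  have hd : ∀ w ∈ e.target, fderiv ℝ (fun w => f (e.symm w)) w = 0 := by
    intro w hw
    have hp := e.map_target hw
    have h1 : dz e f (e.symm w) = 0 := h e he _ hp
    have h2 : dzbar e f (e.symm w) = 0 := by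
      rw [← star_dz (hf.diffAt he hp) hs, h1]
      exact star_zero (End n)
    ext1 v
    have h3 := diffIn_eq (e := e) (p := e.symm w) f v
    rw [h1, h2] at h3
    unfold diffIn at h3
    rw [e.right_inv hw] at h3
    have h0 : ∀ c : ℂ, c • (0 : End n) = 0 := fun c => by
      ext1 x; exact smul_zero (A := Cn n) c
    rw [h0, h0] at h3
    exact h3.trans (add_zero _)
  have hU : e.source ∩ e ⁻¹' Metric.ball (e x) r ∈ nhds x :=
    (e.isOpen_inter_preimage Metric.isOpen_ball).mem_nhds ⟨hx, Metric.mem_ball_self hr⟩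
  filter_upwards [hU] with y hy
  -- Read in the chart, `f` has zero real differential on a ball, hence is constant there;
  -- connectedness of M makes this global.
  have h4 := Metric.isOpen_ball.is_const_of_fderiv_eq_zero (𝕜 := ℝ)
    (convex_ball (e x) r).isPreconnected (f := fun w => f (e.symm w))
    (fun w hw => (differentiableAt_coord hf he (hball hw)).differentiableWithinAt)
    (fun w hw => hd w (hball hw)) hy.2 (Metric.mem_ball_self hr)
  simpa only [e.left_inv hy.1, e.left_inv hx] using h4

/-- If `A'` vanishes between pieces of different type, then `φ` is constant. -/
theorem constant_of_not_isEdge [ConnectedSpace M] (hφ : IsSubbundle φ)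
    (hZ : IsAzFiltration (fun p => cartan (φ p)) t Z) (hsplit : Splits φ t Z)
    (h : ∀ a < 2 * t + 2, ∀ b < 2 * t + 2, a % 2 ≠ b % 2 →
      ¬ IsEdge (fun p => proj (piece φ Z a p)) (fun p => proj (piece φ Z b p))) (p q : M) :
    φ p = φ q := by
  have hP := isSubbundle_iff.1 hφ
  have hF := isFrame_piece hφ hZ hsplit
  have hconst : proj (φ p) = proj (φ q) := by
    refine constant_of_dz_eq_zero hP (fun q => star_proj _) ?_ p q
    intro e he p hp
    have hzero : ∀ a ∈ Finset.range (2 * t + 2), ∀ b ∈ Finset.range (2 * t + 2),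
        proj (piece φ Z b p) * dz e (fun q => proj (φ q)) p * proj (piece φ Z a p) = 0 := by
      intro a ha b hb
      by_cases hab : a % 2 = b % 2
      · have h1 := dz_mul hp (hP.diffAt he hp) (hP.diffAt he hp)
        simp only [proj_mul_self] at h1
        refine mul_mul_eq_zero_of_derivation h1 ?_
        rw [proj_mul_piece, piece_mul_proj, hab]
        split_ifs <;> simp
      · have h2 : proj (piece φ Z b p) * dz e (fun q => proj (piece φ Z a q)) p *
            proj (piece φ Z a p) = 0 := by
          by_contra hcon
          exact h a (Finset.mem_range.1 ha) b (Finset.mem_range.1 hb) hab ⟨e, he, p, hp, hcon⟩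
        exact (piece_dz_piece_eq_zero_iff hφ he hp (hF.smooth a ha) hab).1 h2
    -- Insert the resolution of the identity by the pieces on both sides: every block vanishes, by
    -- Leibniz for equal parities and by hypothesis otherwise.
    have h1 : dz e (fun q => proj (φ q)) p =
        (∑ b ∈ Finset.range (2 * t + 2), proj (piece φ Z b p)) * dz e (fun q => proj (φ q)) p *
          (∑ a ∈ Finset.range (2 * t + 2), proj (piece φ Z a p)) := by
      have h2 : ∑ b ∈ Finset.range (2 * t + 2), proj (piece φ Z b p) = 1 := hF.sum_eq p
      rw [h2, one_mul, mul_one]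
    rw [h1, Finset.mul_sum]
    refine Finset.sum_eq_zero fun a ha => ?_
    rw [Finset.sum_mul, Finset.sum_mul]
    exact Finset.sum_eq_zero fun b hb => hzero a ha b hb
  ext x
  rw [← proj_apply_eq_self_iff, ← proj_apply_eq_self_iff, hconst]

end Edges

/-! ### Combinatorics of positions -/

/-- The positions `f j ≤ s` given to the elements of `N`: they have parity `j + c`, increase along
edges joining elements of different parity, and do not increase along the others. -/
structure IsLevel (N : Finset ℕ) (E : ℕ → ℕ → Prop) (s c : ℕ) (f : ℕ → ℕ) : Prop where
  le : ∀ j ∈ N, f j ≤ s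
  parity : ∀ j ∈ N, f j % 2 = (j + c) % 2
  cross : ∀ a ∈ N, ∀ b ∈ N, E a b → a % 2 ≠ b % 2 → f a < f b
  same : ∀ a ∈ N, ∀ b ∈ N, E a b → a % 2 = b % 2 → f b ≤ f a

/-- Lowering everything above `i` by 2 preserves parity. An edge rising across the cut by an odd
amount rises by at least 3, as a rise by 1 would run from `i` to `i + 1`; an edge falling across it
falls by at least 2. So both conditions survive. -/
theorem IsLevel.collapse {N : Finset ℕ} {E : ℕ → ℕ → Prop} {s c : ℕ} {f : ℕ → ℕ}
    (h : IsLevel N E (s + 2) c f) {i : ℕ} (hi : i < s + 2)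
    (hE : ∀ a ∈ N, ∀ b ∈ N, E a b → f a = i → f b ≠ i + 1) :
    ∃ c' f', IsLevel N E (s + 1) c' f' := by
  rcases Nat.eq_zero_or_pos i with rfl | hpos
  · refine ⟨c + 1, fun j => if f j = 0 then 1 else f j - 1, ?_, ?_, ?_, ?_⟩
    · intro j hj
      have := h.le j hj
      grind
    · intro j hj
      have := h.parity j hj
      grind
    · intro a ha b hb hab hne
      have := h.cross a ha b hb hab hne
      have := hE a ha b hb hab
      have := h.parity a ha
      have := h.parity b hb
      grind
    · intro a ha b hb hab hne
      have := h.same a ha b hb hab hne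
      have := h.parity a ha
      have := h.parity b hb
      grind
  · refine ⟨c, fun j => if f j ≤ i then f j else f j - 2, ?_, ?_, ?_, ?_⟩
    · intro j hj
      have := h.le j hj
      grind
    · intro j hj
      have := h.parity j hj
      grind
    · intro a ha b hb hab hne
      have := h.cross a ha b hb hab hne
      have := hE a ha b hb hab
      have := h.parity a ha
      have := h.parity b hb
      grind
    · intro a ha b hb hab hne
      have := h.same a ha b hb hab hne
      have := h.parity a ha
      have := h.parity b hb
      grind

/-- A shortest system of positions uses all of them, and there is an edge between any two
consecutive ones unless no edge joins elements of different parity. -/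
theorem IsLevel.exists_reduced {N : Finset ℕ} (hN : N.Nonempty) {E : ℕ → ℕ → Prop} {s₀ c₀ : ℕ}
    {f₀ : ℕ → ℕ} (h₀ : IsLevel N E s₀ c₀ f₀) :
    ∃ s c f, IsLevel N E s c f ∧ (∀ i ≤ s, ∃ j ∈ N, f j = i) ∧
      ((∃ a ∈ N, ∃ b ∈ N, E a b ∧ a % 2 ≠ b % 2) →
        ∀ i < s, ∃ a ∈ N, ∃ b ∈ N, E a b ∧ f a = i ∧ f b = i + 1) := by
  classical
  have hex : ∃ s, ∃ c f, IsLevel N E s c f := ⟨s₀, c₀, f₀, h₀⟩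
  obtain ⟨c, f, hf⟩ := Nat.find_spec hex
  have hmin := fun s hs => Nat.find_min hex (m := s) hs
  generalize Nat.find hex = s at hf hmin
  refine ⟨s, c, f, hf, ?_⟩
  match s, hf, hmin with
  | 0, hf, hmin =>
    refine ⟨fun i hi => ?_, fun _ i hi => by omega⟩
    obtain ⟨j, hj⟩ := hN
    exact ⟨j, hj, by have := hf.le j hj; omega⟩
  | 1, hf, hmin =>
    constructor
    · intro i hi
      by_contra hcon
      push Not at hcon
      -- If position `i` is empty, everything sits at `1 - i`; the new offset moves that common
      -- parity to 0.
      refine hmin 0 (by omega) ⟨c + i + 1, fun _ => 0, ?_, ?_, ?_, ?_⟩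
      · intro j hj; omega
      · intro j hj
        have := hf.le j hj
        have := hf.parity j hj
        have := hcon j hj
        grind
      · intro a ha b hb hab hne
        have := hf.parity a ha
        have := hf.parity b hb
        have := hf.le a ha
        have := hf.le b hb
        have := hcon a ha
        have := hcon b hb
        grind
      · intros; exact le_rfl
    · rintro ⟨a, ha, b, hb, hab, hne⟩ i hi
      have := hf.cross a ha b hb hab hne
      have := hf.le b hb
      exact ⟨a, ha, b, hb, hab, by omega, by omega⟩
  | s + 2, hf, hmin =>
    have key : ∀ i < s + 2, ∃ a ∈ N, ∃ b ∈ N, E a b ∧ f a = i ∧ f b = i + 1 := by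
      intro i hi
      by_contra hcon
      push Not at hcon
      exact hmin (s + 1) (by omega) (hf.collapse hi hcon)
    refine ⟨fun i hi => ?_, fun _ => key⟩
    rcases Nat.lt_or_ge i (s + 2) with h | h
    · obtain ⟨a, ha, _, _, _, h1, _⟩ := key i h
      exact ⟨a, ha, h1⟩
    · obtain ⟨_, _, b, hb, _, _, h1⟩ := key (s + 1) (by omega)
      exact ⟨b, hb, by omega⟩

/-- The indices of the pieces that do not vanish identically. -/
def support {M : Type*} {n : ℕ} (φ : M → Submodule ℂ (Cn n)) (Z : ℕ → M → Submodule ℂ (Cn n)) (t : ℕ) :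
    Finset ℕ := by
  classical exact {j ∈ Finset.range (2 * t + 2) | ∃ p, proj (piece φ Z j p) ≠ 0}

/-- The sum of the pieces at position `i`. -/
def levelLeg {M : Type*} {n : ℕ} (φ : M → Submodule ℂ (Cn n)) (Z : ℕ → M → Submodule ℂ (Cn n)) (t : ℕ)
    (f : ℕ → ℕ) (i : ℕ) (p : M) : Submodule ℂ (Cn n) :=
  ⨆ j ∈ (support φ Z t).filter (fun j => f j = i), piece φ Z j p

theorem mem_support {M : Type*} {n : ℕ} {φ : M → Submodule ℂ (Cn n)}
    {Z : ℕ → M → Submodule ℂ (Cn n)} {t j : ℕ} :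
    j ∈ support φ Z t ↔ j < 2 * t + 2 ∧ ∃ p, proj (piece φ Z j p) ≠ 0 := by
  simp [support]

theorem piece_le_levelLeg {M : Type*} {n : ℕ} {φ : M → Submodule ℂ (Cn n)}
    {Z : ℕ → M → Submodule ℂ (Cn n)} {t : ℕ} (f : ℕ → ℕ) {j : ℕ} (hj : j ∈ support φ Z t) (p : M) :
    piece φ Z j p ≤ levelLeg φ Z t f (f j) p :=
  le_iSup₂_of_le (f := fun k (_ : k ∈ (support φ Z t).filter (fun k => f k = f j)) =>
    piece φ Z k p) j (Finset.mem_filter.2 ⟨hj, rfl⟩) le_rfl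

/-! ### The flag map defined by a placement -/

section Construction

variable {M : Type*} [TopologicalSpace M] [ChartedSpace ℂ M] {n : ℕ}
  {φ : M → Submodule ℂ (Cn n)} {t : ℕ} {Z : ℕ → M → Submodule ℂ (Cn n)}

theorem isFrame_support (hφ : IsSubbundle φ) (hZ : IsAzFiltration (fun p => cartan (φ p)) t Z)
    (hsplit : Splits φ t Z) :
    IsFrame (support φ Z t) fun j p => proj (piece φ Z j p) := by
  refine (isFrame_piece hφ hZ hsplit).subset
    (fun j hj => Finset.mem_range.2 (mem_support.1 hj).1) fun j hj hjS p => ?_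
  by_contra hne
  exact hjS (mem_support.2 ⟨Finset.mem_range.1 hj, p, hne⟩)

theorem mem_support_of_isEdge_left {a b : ℕ} (ha : a < 2 * t + 2)
    (hE : IsEdge (fun p => proj (piece φ Z a p)) (fun p => proj (piece φ Z b p))) :
    a ∈ support φ Z t := by
  obtain ⟨e, -, p, -, hne⟩ := hE
  exact mem_support.2 ⟨ha, p, right_ne_zero_of_mul hne⟩

theorem mem_support_of_isEdge_right {a b : ℕ} (hb : b < 2 * t + 2)
    (hE : IsEdge (fun p => proj (piece φ Z a p)) (fun p => proj (piece φ Z b p))) :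
    b ∈ support φ Z t := by
  obtain ⟨e, -, p, -, hne⟩ := hE
  exact mem_support.2 ⟨hb, p, left_ne_zero_of_mul (left_ne_zero_of_mul hne)⟩

theorem proj_levelLeg (hF : IsFrame (support φ Z t) fun j p => proj (piece φ Z j p))
    (f : ℕ → ℕ) (i : ℕ) (p : M) :
    proj (levelLeg φ Z t f i p) =
      fibreSum (support φ Z t) (fun j p => proj (piece φ Z j p)) f i p :=
  proj_iSup fun j hj k hk hjk => isOrtho_of_proj_mul_proj
    (hF.orth j (Finset.mem_filter.1 hj).1 k (Finset.mem_filter.1 hk).1 hjk p)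

variable {s c : ℕ} {f : ℕ → ℕ}

theorem isFrame_levelLeg (hF : IsFrame (support φ Z t) fun j p => proj (piece φ Z j p))
    (hf : ∀ j ∈ support φ Z t, f j ≤ s) :
    IsFrame (Finset.univ : Finset (Fin (s + 1))) fun i p => proj (levelLeg φ Z t f i p) := by
  have h := hF.fibreSum (K := Finset.range (s + 1)) (f := f)
    fun j hj => Finset.mem_range.2 (Nat.lt_succ_of_le (hf j hj))
  have hmem : ∀ i : Fin (s + 1), (i : ℕ) ∈ Finset.range (s + 1) := fun i => Finset.mem_range.2 i.2
  have heq : ∀ i : ℕ, (fun p => proj (levelLeg φ Z t f i p)) =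
      fibreSum (support φ Z t) (fun j p => proj (piece φ Z j p)) f i :=
    fun i => funext (proj_levelLeg hF f i)
  refine ⟨fun i _ => ?_, fun i _ p => star_proj _, fun i _ p => proj_mul_self _,
    fun i _ j _ hij p => ?_, fun p => ?_⟩
  · rw [heq]
    exact h.smooth i (hmem i)
  · simp only [proj_levelLeg hF]
    exact h.orth i (hmem i) j (hmem j) (fun h => hij (Fin.ext h)) p
  · simp only [proj_levelLeg hF]
    rw [Fin.sum_univ_eq_sum_range
      (fun i => fibreSum (support φ Z t) (fun j p => proj (piece φ Z j p)) f i p) (s + 1)]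
    exact h.sum_eq p

/-- The map into the flag manifold whose legs are the sums of the pieces at the same position. -/
def levelFlag [ConnectedSpace M] (hF : IsFrame (support φ Z t) fun j p => proj (piece φ Z j p))
    (hf : ∀ j ∈ support φ Z t, f j ≤ s) (p₀ p : M) :
    Flag n (fun i : Fin (s + 1) => Module.finrank ℂ (levelLeg φ Z t f i p₀)) where
  leg i := levelLeg φ Z t f i p
  finrank_leg i := finrank_constant ((isFrame_levelLeg hF hf).smooth i (Finset.mem_univ i)) p p₀
  ortho i j hij := isOrtho_of_proj_mul_proj
    ((isFrame_levelLeg hF hf).orth i (Finset.mem_univ i) j (Finset.mem_univ j) hij p)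
  sum_eq_top := by
    refine eq_top_iff.2 fun x _ => ?_
    have h := congrArg (fun g : End n => g x) ((isFrame_levelLeg hF hf).sum_eq p)
    simp only [sum_apply] at h
    rw [show x = (1 : End n) x from rfl, ← h]
    exact Submodule.sum_mem _ fun i _ => Submodule.mem_iSup_of_mem i (proj_mem _ _)

/-- A piece at an even position has index of the parity of `c`, so it lies in φ if `c` is even and
in φ^⊥ otherwise; the remaining pieces are orthogonal to that subspace. -/
theorem evenSum_levelFlag [ConnectedSpace M]
    (hF : IsFrame (support φ Z t) fun j p => proj (piece φ Z j p))
    (hf : ∀ j ∈ support φ Z t, f j ≤ s)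
    (hpar : ∀ j ∈ support φ Z t, f j % 2 = (j + c) % 2) (p₀ p : M) :
    (levelFlag hF hf p₀ p).evenSum = if Even c then φ p else (φ p)ᗮ := by
  have hle : ∀ j, (Even j ↔ Even c) → piece φ Z j p ≤ if Even c then φ p else (φ p)ᗮ := by
    intro j hj
    have := piece_le_right φ Z j p
    simpa only [hj] using this
  have hort : ∀ j, ¬ (Even j ↔ Even c) →
      piece φ Z j p ⟂ if Even c then φ p else (φ p)ᗮ := by
    intro j hj
    have := piece_le_right φ Z j p
    by_cases hc : Even c
    · rw [if_neg (by tauto)] at this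
      rw [if_pos hc]
      exact (Submodule.isOrtho_orthogonal_left _).mono_left this
    · rw [if_pos (by tauto)] at this
      rw [if_neg hc]
      exact (Submodule.isOrtho_orthogonal_right _).mono_left this
  have hiff : ∀ j ∈ support φ Z t, ((Even j ↔ Even c) ↔ Even (f j)) := by
    intro j hj
    have := hpar j hj
    simp only [Nat.even_iff]
    omega
  refine le_antisymm ?_ fun x hx => ?_
  · refine iSup₂_le fun i hi => iSup₂_le fun j hj => ?_
    obtain ⟨hj, hji⟩ := Finset.mem_filter.1 hj
    exact hle j ((hiff j hj).2 (hji ▸ hi))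
  · have h := congrArg (fun g : End n => g x) (hF.sum_eq p)
    simp only [sum_apply] at h
    rw [show x = (1 : End n) x from rfl, ← h]
    refine Submodule.sum_mem _ fun j hj => ?_
    by_cases hj' : Even j ↔ Even c
    · have h1 : levelLeg φ Z t f (f j) p ≤ (levelFlag hF hf p₀ p).evenSum :=
        le_iSup₂_of_le (f := fun (i : Fin (s + 1)) (_ : Even (i : ℕ)) => levelLeg φ Z t f i p)
          ⟨f j, Nat.lt_succ_of_le (hf j hj)⟩ ((hiff j hj).1 hj') le_rfl
      exact h1 (piece_le_levelLeg f hj p (proj_mem _ _))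
    · rw [proj_apply_eq_zero_of_isOrtho (hort j hj') hx]
      exact Submodule.zero_mem _

theorem support_nonempty [Nonempty M] (hn : 0 < n)
    (hF : IsFrame (support φ Z t) fun j p => proj (piece φ Z j p)) :
    (support φ Z t).Nonempty := by
  by_contra hcon
  obtain ⟨p⟩ := ‹Nonempty M›
  have h := hF.sum_eq p
  rw [Finset.not_nonempty_iff_eq_empty.1 hcon, Finset.sum_empty] at h
  have : Nonempty (Fin n) := ⟨⟨0, hn⟩⟩
  exact zero_ne_one h

/-- A supported piece is nonzero somewhere, and the constant rank carries this to the base point. -/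
theorem finrank_levelLeg_pos [ConnectedSpace M]
    (hF : IsFrame (support φ Z t) fun j p => proj (piece φ Z j p))
    (hf : ∀ j ∈ support φ Z t, f j ≤ s) {j : ℕ} (hj : j ∈ support φ Z t) (p₀ : M) :
    0 < Module.finrank ℂ (levelLeg φ Z t f (f j) p₀) := by
  obtain ⟨p, hp⟩ := (mem_support.1 hj).2
  have h := finrank_constant ((isFrame_levelLeg hF hf).smooth ⟨f j, Nat.lt_succ_of_le (hf j hj)⟩
    (Finset.mem_univ _)) p₀ p
  rw [h, Module.finrank_pos_iff, Submodule.nontrivial_iff_ne_bot]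
  intro hbot
  refine hp ?_
  ext1 x
  exact (Submodule.mem_bot ℂ).1 (hbot ▸ piece_le_levelLeg f hj p (proj_mem _ x))

variable [IsManifold 𝓘(ℂ) ω M]

/-- A nonzero component of `∂_z` of a projection is a nonzero second fundamental form. -/
theorem not_secondFFZero_of_isEdge {V W V' W' : M → Submodule ℂ (Cn n)}
    (hV : SmoothEnd fun p => proj (V p)) (hVV' : ∀ p, V p ≤ V' p) (hWW' : ∀ p, W p ≤ W' p)
    (hE : IsEdge (fun p => proj (V p)) (fun p => proj (W p))) : ¬ SecondFFZero V' W' := by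
  obtain ⟨e, he, p, hp, hne⟩ := hE
  intro h
  refine hne ?_
  ext1 w
  -- Projecting the fixed vector `proj (V p) w` to each `V q` gives a smooth section of `V'` whose
  -- ∂_z is given by the derivative of the projection.
  have h1 := h e he (fun q => proj (V q) (proj (V p) w))
    ⟨(hV.apply _).contMDiffOn, fun q _ => hVV' q (proj_mem _ _)⟩ p hp
  rw [dz_apply (hV.diffAt he hp)] at h1
  change proj (W p) (dz e (fun q => proj (V q)) p (proj (V p) w)) = 0
  rw [← proj_mul_proj_of_le' (hWW' p)]
  change proj (W p) (proj (W' p) _) = 0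
  rw [h1, map_zero]

/-- Edges between nonvanishing pieces, and their positions in the filtration. -/
theorem isLevel_piece (hφ : IsSubbundle φ) (hZ : IsAzFiltration (fun p => cartan (φ p)) t Z)
    (hsplit : Splits φ t Z) :
    IsLevel (support φ Z t) (fun a b => IsEdge (fun p => proj (piece φ Z a p))
      (fun p => proj (piece φ Z b p))) (2 * t + 1) 0 id where
  le j hj := by
    have := (mem_support.1 hj).1
    simp only [id]
    omega
  parity j _ := rfl
  cross a ha b _ hE hab := by
    have := isEdge_cross hφ hZ hsplit (mem_support.1 ha).1 hab hE
    simp only [id]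
    omega
  same a ha b hb hE hab := by
    have := isEdge_same hφ hZ hsplit (mem_support.1 ha).1 (mem_support.1 hb).1 hab hE
    simp only [id]
    omega

theorem isJ2Holomorphic_levelFlag [ConnectedSpace M]
    (hF : IsFrame (support φ Z t) fun j p => proj (piece φ Z j p))
    (hL : IsLevel (support φ Z t) (fun a b => IsEdge (fun p => proj (piece φ Z a p))
      (fun p => proj (piece φ Z b p))) s c f) (p₀ : M) :
    IsJ2Holomorphic (levelFlag hF hL.le p₀) := by
  refine isJ2Holomorphic_of_isEdge (isFrame_levelLeg hF hL.le) fun i j hij hE => ?_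
  by_contra hone
  have heq : ∀ i : ℕ, (fun p => proj (levelLeg φ Z t f i p)) =
      fibreSum (support φ Z t) (fun j p => proj (piece φ Z j p)) f i :=
    fun i => funext (proj_levelLeg hF f i)
  have hE' : IsEdge (fun p => proj (levelLeg φ Z t f i p))
    (fun p => proj (levelLeg φ Z t f j p)) := hE
  have hij' : (i : ℕ) ≠ j := fun h => hij (Fin.ext h)
  rw [heq, heq] at hE'
  refine hF.not_isEdge_fibreSum hij' (fun a ha b hb hab hai hbj => hone ?_) hE'
  have h1 := hL.cross a ha b hb hab
  have h2 := hL.same a ha b hb hab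
  have h3 := hL.parity a ha
  have h4 := hL.parity b hb
  unfold Flag.IsOneZero
  rw [Fin.lt_def, Fin.lt_def, Nat.odd_iff, Nat.even_iff]
  by_cases hpar : a % 2 = b % 2
  · have := h2 hpar
    omega
  · have := h1 hpar
    omega

end Construction

end TwistorLift

end

/-! ### The proposition -/

open TwistorLift in
theorem mainTheorem3 {M : Type*} [TopologicalSpace M] [T2Space M] [ConnectedSpace M]
    [ChartedSpace ℂ M] [IsManifold 𝓘(ℂ) ω M] {n : ℕ} (hn : 0 < n)
    (φ : M → Submodule ℂ (Cn n)) (hφ : IsSubbundle φ)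
    (t : ℕ) (Z : ℕ → M → Submodule ℂ (Cn n))
    (hZ : IsAzFiltration (fun p => cartan (φ p)) t Z) (hsplit : Splits φ t Z) :
    ∃ (s : ℕ) (d : Fin (s + 1) → ℕ) (ψ : M → Flag n d),
      (∀ i, 0 < d i) ∧
      (s = 0 → (∀ p, φ p = ⊥) ∨ (∀ p, φ p = ⊤)) ∧
      (IsJ2Lift ψ φ ∨ IsJ2Lift ψ (fun p => (φ p)ᗮ)) ∧
      (∀ i, ∃ S ⊆ Finset.range (2 * t + 2), ∀ p, (ψ p).leg i = ⨆ j ∈ S, piece φ Z j p) ∧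
      ((∃ p q, φ p ≠ φ q) →
        ∀ i : Fin s, ¬ SecondFFZero (fun p => (ψ p).leg i.castSucc)
          (fun p => (ψ p).leg i.succ)) := by
  have hF := isFrame_support hφ hZ hsplit
  obtain ⟨s, c, f, hL, hsurj, hedge⟩ :=
    (isLevel_piece hφ hZ hsplit).exists_reduced (support_nonempty hn hF)
  -- The base point serves only to read off the dimensions of the legs.
  obtain ⟨p₀⟩ : Nonempty M := inferInstance
  have heven := evenSum_levelFlag hF hL.le hL.parity p₀
  refine ⟨s, _, levelFlag hF hL.le p₀, ?_, ?_, ?_, ?_, ?_⟩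
  · intro i
    obtain ⟨j, hj, hji⟩ := hsurj i (Nat.le_of_lt_succ i.2)
    have h := finrank_levelLeg_pos hF hL.le hj p₀
    rwa [hji] at h
  · rintro rfl
    have htop : ∀ p, (levelFlag hF hL.le p₀ p).evenSum = ⊤ := by
      intro p
      rw [← (levelFlag hF hL.le p₀ p).sum_eq_top]
      refine le_antisymm (iSup₂_le fun i _ => le_iSup _ i) (iSup_le fun i => ?_)
      exact le_iSup₂_of_le (f := fun (i : Fin (0 + 1)) (_ : Even (i : ℕ)) =>
        (levelFlag hF hL.le p₀ p).leg i) i (by simp) le_rfl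
    by_cases hc : Even c
    · refine Or.inr fun p => ?_
      rw [← htop p, heven, if_pos hc]
    · refine Or.inl fun p => ?_
      have h := htop p
      rw [heven, if_neg hc] at h
      exact (Submodule.orthogonal_eq_top_iff _).1 h
  · have hhol := isJ2Holomorphic_levelFlag hF hL p₀
    by_cases hc : Even c
    · exact Or.inl ⟨hhol, fun p => by rw [heven, if_pos hc]⟩
    · exact Or.inr ⟨hhol, fun p => by rw [heven, if_neg hc]⟩
  · intro i
    exact ⟨(support φ Z t).filter fun j => f j = i, fun j hj =>
      Finset.mem_range.2 (mem_support.1 (Finset.mem_filter.1 hj).1).1, fun p => rfl⟩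
  · rintro ⟨p, q, hpq⟩ i
    have hcross : ∃ a ∈ support φ Z t, ∃ b ∈ support φ Z t,
        IsEdge (fun p => proj (piece φ Z a p)) (fun p => proj (piece φ Z b p)) ∧
          a % 2 ≠ b % 2 := by
      by_contra hcon
      push Not at hcon
      -- The endpoints of an edge are nonzero pieces, so restricting to the support loses no edges.
      refine hpq (constant_of_not_isEdge hφ hZ hsplit (fun a ha b hb hab hE => hab ?_) p q)
      exact hcon a (mem_support_of_isEdge_left ha hE) b (mem_support_of_isEdge_right hb hE) hE
    obtain ⟨a, ha, b, hb, hE, hai, hbi⟩ := hedge hcross i i.2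
    refine not_secondFFZero_of_isEdge (hF.smooth a ha) (fun p => ?_) (fun p => ?_) hE
    · have h := piece_le_levelLeg f ha p
      rwa [hai] at h
    · have h := piece_le_levelLeg f hb p
      rwa [hbi] at h
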